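/- **Setting.** Let $f(1),f(2),\dots$ be real numbers and let $X(1),X(2),\dots$ be real random variables. For each $T$ let $L=L_T>1$ be an integer, $N=\lfloor T/L\rfloor-1$ with $L\le N$ for all large $T$, and let $p=p_T$. Let $\boldsymbol X=[X(i+(j-1)L)]_{i\le L,\,j\le N}$ and $\boldsymbol M=[f(i+(j-1)L)]_{i\le L,\,j\le N}$ be the Page matrices. For each $T$, every entry of $\boldsymbol X$ is either observed or missing. Let $\boldsymbol Y$ be $\boldsymbol X$ with missing entries replaced by $0$, and let $\hat p=\max\{\frac{\#\text{observed entries}}{LN},\frac1{LN}\}$. Write $\|X\|_{\psi_2}=\inf\{t>0:\mathbb E\exp(X^2/t^2)\le 2\}$, and let $\|\cdot\|$, $\|\cdot\|_*$, $\|\cdot\|_F$ be the spectral, nuclear and Frobenius norms. For a constant $\sigma$, $f$ is called *$(r,\delta_1)$-imputable* (at $T$) if $p\in(0,1]$; the entries of $\boldsymbol X$, each taken with its observation indicator, are independent over the entries; each entry satisfies $\mathbb E[X_{ij}]=M_{ij}$ and $\|X_{ij}\|_{\psi_2}\le\sigma$, and is observed with probability $p$, independently of its value; and there is a matrix $\boldsymbol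 M_{(r)}$ of rank at most $r$ with $\max_{i,j}|M_{ij}-(\boldsymbol M_{(r)})_{ij}|\le\delta_1$. A matrix estimation algorithm $\mathrm{ME}$ is, for every matrix size, a measurable map from matrices with missing entries to real matrices. Put $\widehat{\boldsymbol M}=\mathrm{ME}(\boldsymbol X)$ (computed from the observed entries only) and $\hat f_I(i+(j-1)L)=\widehat M_{ij}$ for $i\le L$, $j\le N$. The imputation error is $$\mathrm{MSE}(\hat f_I,f)=\frac{\mathbb E\sum_{t=1}^{LN}(\hat f_I(t)-f(t))^2}{\sum_{t=1}^{LN}f(t)^2}=\frac{\mathbb E\|\widehat{\boldsymbol M}-\boldsymbol M\|_F^2}{\|\boldsymbol M\|_F^2}.$$ **Statement.** Let $\sigma\ge 0$, $C_1$, $\zeta\in(0,1)$, $\epsilon_1,\epsilon_2\in(0,1)$ and $C_5,C_6>0$ be constants not depending on $T$. Assume that, for all large $T$: 1. $\mathrm{ME}$ has the guarantee that, if $p\ge\max(L,N)^{-1+\zeta}$, then almost surely $$\|\hat p\,\widehat{\boldsymbol M}-p\boldsymbol M\|_F^2\le C_1\,\|\boldsymbol Y-p\boldsymbol M\|\,\|p\boldsymbol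 M\|_*,$$ and $p$ lies in this range, $p\ge\max(L,N)^{-1+\zeta}$; 2. $f$ is $(C_5L^{1-\epsilon_2},\,C_6L^{-\epsilon_1})$-imputable. Assume further that $\sum_{t=1}^T f(t)^2=\Omega(T)$ and that $p\gg L^{-\min(2\epsilon_1,\epsilon_2)}$, i.e. $L^{-\min(2\epsilon_1,\epsilon_2)}/p\to0$ as $T\to\infty$. Then $$\lim_{T\to\infty}\mathrm{MSE}(\hat f_I,f)=0.$$ -/

import Mathlib

open MeasureTheory ProbabilityTheory Filter Topology Asymptotics
open scoped ENNReal NNReal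

noncomputable section

/-! ### Matrix norms -/

/-- The spectral (operator) norm of a real matrix, for the Euclidean norms. -/
def spectralNorm₂ {m n : ℕ} (A : Matrix (Fin m) (Fin n) ℝ) : ℝ :=
  ‖LinearMap.toContinuousLinearMap (Matrix.toEuclideanLin A)‖

/-- The nuclear norm: the sum of the `min m n` singular values. -/
def nuclearNorm {m n : ℕ} (A : Matrix (Fin m) (Fin n) ℝ) : ℝ :=
  ∑ i ∈ Finset.range (min m n), (Matrix.toEuclideanLin A).singularValues i

/-- The squared Frobenius norm. -/
def frobeniusSq {m n : ℕ} (A : Matrix (Fin m) (Fin n) ℝ) : ℝ :=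
  ∑ i, ∑ j, A i j ^ 2

/-! ### Sub-gaussian norm -/

/-- The sub-gaussian norm `inf {t > 0 : E exp (X² / t²) ≤ 2}`, which is `∞` if there is no such
`t`. -/
def psi2Norm {Ω : Type*} [MeasurableSpace Ω] (μ : Measure Ω) (X : Ω → ℝ) : ℝ≥0∞ :=
  ⨅ t : {t : ℝ≥0 // 0 < t ∧ ∫⁻ ω, ENNReal.ofReal (Real.exp (X ω ^ 2 / (t : ℝ) ^ 2)) ∂μ ≤ 2},
    ((t : ℝ≥0) : ℝ≥0∞)

/-! ### Partially observed matrices and matrix estimation -/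

/-- The data matrix: the entry `v i j` if it is observed, `none` if it is missing. -/
def observe {m n : ℕ} (mask : Matrix (Fin m) (Fin n) Bool) (v : Matrix (Fin m) (Fin n) ℝ) :
    Matrix (Fin m) (Fin n) (Option ℝ) :=
  Matrix.of fun i j => if mask i j then some (v i j) else none

/-- A matrix estimation algorithm: for every size, a map from noisy matrices with missing entries
to real matrices, measurable in the observed values for every pattern of observed entries. -/
structure MatrixEstimator where
  est : ∀ m n : ℕ, Matrix (Fin m) (Fin n) (Option ℝ) → Matrix (Fin m) (Fin n) ℝ
  measurable_est : ∀ (m n : ℕ) (mask : Matrix (Fin m) (Fin n) Bool) (i : Fin m) (j : Fin n),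
    Measurable fun v : Fin m → Fin n → ℝ => est m n (observe mask (Matrix.of v)) i j

/-- `Y`: the data matrix with the missing entries replaced by `0`. -/
def zeroFill {m n : ℕ} (D : Matrix (Fin m) (Fin n) (Option ℝ)) : Matrix (Fin m) (Fin n) ℝ :=
  Matrix.of fun i j => (D i j).getD 0

/-- `p̂`: the proportion of observed entries, but at least `1 / (m n)`. -/
def observedFraction {m n : ℕ} (D : Matrix (Fin m) (Fin n) (Option ℝ)) : ℝ :=
  max ((∑ i, ∑ j, if (D i j).isSome then (1 : ℝ) else 0) / ((m : ℝ) * n)) (1 / ((m : ℝ) * n))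

/-- The random data matrix obtained from the random matrix `X` and the random pattern `O` of
observed entries. -/
def dataMatrix {Ω : Type*} {m n : ℕ} (X : Matrix (Fin m) (Fin n) (Ω → ℝ))
    (O : Matrix (Fin m) (Fin n) (Ω → Bool)) (ω : Ω) : Matrix (Fin m) (Fin n) (Option ℝ) :=
  observe (Matrix.of fun i j => O i j ω) (Matrix.of fun i j => X i j ω)

/-- The guarantee required of the matrix estimation algorithm on the model `(X, O, M, p)`: as soon
as `p ≥ max (m, n) ^ (-1 + ζ)`, the estimate `M̂` almost surely satisfies
`‖p̂ M̂ - p M‖_F² ≤ C₁ ‖Y - p M‖ ‖p M‖_*`. -/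
def EstimationGuarantee (ME : MatrixEstimator) (C₁ ζ : ℝ)
    {Ω : Type*} [MeasurableSpace Ω] (μ : Measure Ω) {m n : ℕ}
    (X : Matrix (Fin m) (Fin n) (Ω → ℝ)) (O : Matrix (Fin m) (Fin n) (Ω → Bool))
    (M : Matrix (Fin m) (Fin n) ℝ) (p : ℝ) : Prop :=
  (max m n : ℝ) ^ (-1 + ζ) ≤ p →
    ∀ᵐ ω ∂μ,
      frobeniusSq (observedFraction (dataMatrix X O ω) • ME.est m n (dataMatrix X O ω) - p • M)
        ≤ C₁ * spectralNorm₂ (zeroFill (dataMatrix X O ω) - p • M) * nuclearNorm (p • M)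

/-! ### Page matrices and imputation -/

/-- The number of columns `N = ⌊T / L⌋ - 1`. -/
def numCols (T L : ℕ) : ℕ := T / L - 1

/-- The `L × N` Page matrix of the series `x 1, x 2, …`: its entry in row `i` and column `j`
(counted from `1`) is `x (i + (j - 1) L)`. -/
def pageMatrix {α : Type*} (L N : ℕ) (x : ℕ → α) : Matrix (Fin L) (Fin N) α :=
  Matrix.of fun i j => x ((i : ℕ) + 1 + (j : ℕ) * L)

/-- The `(r, δ₁)`-imputable property for the random matrix `X`, the pattern `O` of observed entries
and the mean matrix `M`, with observation probability `p` and noise level `σ`. -/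
structure IsImputable {Ω : Type*} [MeasurableSpace Ω] (μ : Measure Ω) {m n : ℕ}
    (X : Matrix (Fin m) (Fin n) (Ω → ℝ)) (O : Matrix (Fin m) (Fin n) (Ω → Bool))
    (M : Matrix (Fin m) (Fin n) ℝ) (p : ℝ) (σ : ℝ≥0) (r δ₁ : ℝ) : Prop where
  measurable_X : ∀ i j, Measurable (X i j)
  measurable_O : ∀ i j, Measurable (O i j)
  /-- The entries, each together with its observation indicator, are independent. -/
  indep : iIndepFun (fun (k : Fin m × Fin n) (ω : Ω) => (X k.1 k.2 ω, O k.1 k.2 ω)) μ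
  /-- Whether an entry is observed is independent of its value. -/
  indep_obs : ∀ i j, IndepFun (X i j) (O i j) μ
  mean : ∀ i j, ∫ ω, X i j ω ∂μ = M i j
  subgaussian : ∀ i j, psi2Norm μ (X i j) ≤ σ
  p_pos : 0 < p
  p_le_one : p ≤ 1
  prob_obs : ∀ i j, μ {ω | O i j ω = true} = ENNReal.ofReal p
  low_rank : ∃ A : Matrix (Fin m) (Fin n) ℝ, (A.rank : ℝ) ≤ r ∧ ∀ i j, |M i j - A i j| ≤ δ₁

/-- Read a series off an `L × N` matrix: the value at time `t = i + (j - 1) L` is the entry in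
row `i` and column `j` (counted from `1`). The value at other times plays no role. -/
def seriesOfMatrix {L N : ℕ} (A : Matrix (Fin L) (Fin N) ℝ) (t : ℕ) : ℝ :=
  if h : (t - 1) % L < L ∧ (t - 1) / L < N then A ⟨(t - 1) % L, h.1⟩ ⟨(t - 1) / L, h.2⟩ else 0

/-- The imputation estimate `f̂_I`: apply the matrix estimation algorithm to the observed Page
matrix and read off the series. -/
def imputedSeries (ME : MatrixEstimator) {Ω : Type*} (L N : ℕ) (X : ℕ → Ω → ℝ)
    (O : ℕ → Ω → Bool) (ω : Ω) : ℕ → ℝ :=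
  seriesOfMatrix (ME.est L N (dataMatrix (pageMatrix L N X) (pageMatrix L N O) ω))

/-- The relative mean-squared imputation error `E ‖f̂_I - f‖² / ‖f‖²`, over the times `1, …, L N`
that the Page matrix covers. -/
def imputationMSE (ME : MatrixEstimator) {Ω : Type*} [MeasurableSpace Ω] (μ : Measure Ω)
    (L N : ℕ) (X : ℕ → Ω → ℝ) (O : ℕ → Ω → Bool) (f : ℕ → ℝ) : ℝ≥0∞ :=
  (∫⁻ ω, ENNReal.ofReal
      (∑ t ∈ Finset.Icc 1 (L * N), (imputedSeries ME L N X O ω t - f t) ^ 2) ∂μ) /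
    ENNReal.ofReal (∑ t ∈ Finset.Icc 1 (L * N), f t ^ 2)

end

/-!
The estimation error splits as
`‖M̂ - M‖² ≤ 2 p̂⁻² ‖p̂ M̂ - p M‖² + 2 (p̂ - p)² p̂⁻² ‖M‖²` (Frobenius norms).
The second term is negligible because `p̂` concentrates around `p`: the proportion of observed
entries has variance at most `p / (L N)`, and by a Chernoff bound it is so unlikely to be below
`p / 2` that the trivial bound `p̂ ≥ 1 / (L N)` suffices there. The guarantee bounds the first term
by a multiple of `p⁻² ‖Y - p M‖ ‖p M‖_*`. Pairing `M` with its singular vectors and splitting off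
the low rank approximation gives `‖M‖_* ≤ C √(L ℓ) √(L N)` with `ℓ = L ^ (-min (2 ε₁) ε₂)`
(`nuclearNorm_le`). As `‖M‖² ≥ c L N`, the relative error is at most a multiple of `√(ℓ / p)`,
provided that `E ‖Y - p M‖ ≤ C √(p N)`. No logarithmic factor may be lost here, since `ℓ / p` tends
to `0` without a rate.

This bound on the noise (`IsImputable.integral_spectralNorm₂_noise_le`) comes from the moment method
with a comparison of matrix sizes. After subtraction of an independent copy the entries are
symmetric, with moments of order `2 q` at most `s K ^ q` for `1 ≤ q ≤ k`, where `s = 2 p / k` and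
`K` is a multiple of `k`. Expand `E tr (Z Zᵀ) ^ k` as a sum over closed walks of length `2 k` in the
complete bipartite graph. Only walks that traverse every edge an even number of times contribute,
and such a walk contributes at most `K ^ k s ^ (v - 1)`, where `v` is its number of vertices,
because a connected graph has at least `v - 1` edges. Whether a walk is even depends only on the
equalities among its vertices, so weighting each vertex by `s` replaces the `N` available vertices
by about `s N`: the sum is at most `K ^ k / s` times the number of even walks on `r + r` vertices
with `r ≈ s N + k` (`sum_evenPattern_le`). That number is the expectation of `tr (Y Yᵀ) ^ k` for an
`r × r` matrix `Y` of independent signs, which has norm of order `√r` with high moments by a union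
bound over integer vectors (`evenWalkCount_le`). Altogether `E ‖Z‖` is of order
`√(K r) ≈ √(p N)` for a suitable `k` of order `log N`, and `p ≥ N ^ (-1 + ζ)` leaves room
for this choice, as `k² ≤ p N`.
-/

/-! ### Spectral norm and traces of powers -/

section SpectralNorm

open scoped Matrix Matrix.Norms.L2Operator

lemma spectralNorm₂_eq_norm {m n : ℕ} (A : Matrix (Fin m) (Fin n) ℝ) : spectralNorm₂ A = ‖A‖ := rfl

lemma spectralNorm₂_nonneg {m n : ℕ} (A : Matrix (Fin m) (Fin n) ℝ) : 0 ≤ spectralNorm₂ A :=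
  norm_nonneg _

lemma continuous_spectralNorm₂ {m n : ℕ} :
    Continuous (spectralNorm₂ : Matrix (Fin m) (Fin n) ℝ → ℝ) := by
  have h : Continuous fun A : Matrix (Fin m) (Fin n) ℝ =>
      LinearMap.toContinuousLinearMap (Matrix.toEuclideanLin A) :=
    LinearMap.continuous_of_finiteDimensional
      (LinearMap.toContinuousLinearMap.toLinearMap ∘ₗ
        (Matrix.toEuclideanLin (𝕜 := ℝ) (m := Fin m) (n := Fin n)).toLinearMap)
  exact h.norm

lemma frobeniusSq_nonneg {m n : ℕ} (A : Matrix (Fin m) (Fin n) ℝ) : 0 ≤ frobeniusSq A :=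
  Finset.sum_nonneg fun _ _ => Finset.sum_nonneg fun _ _ => sq_nonneg _

lemma norm_toEuclideanLin_sq_le {m n : ℕ} (A : Matrix (Fin m) (Fin n) ℝ)
    (v : EuclideanSpace ℝ (Fin n)) :
    ‖Matrix.toEuclideanLin A v‖ ^ 2 ≤ frobeniusSq A * ‖v‖ ^ 2 := by
  rw [EuclideanSpace.norm_sq_eq, EuclideanSpace.norm_sq_eq, frobeniusSq, Finset.sum_mul]
  refine Finset.sum_le_sum fun i _ => ?_
  simpa [Matrix.toLpLin_apply, Matrix.mulVec, dotProduct] using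
    Finset.sum_mul_sq_le_sq_mul_sq Finset.univ (A i) v

lemma spectralNorm₂_sq_le_frobeniusSq {m n : ℕ} (A : Matrix (Fin m) (Fin n) ℝ) :
    spectralNorm₂ A ^ 2 ≤ frobeniusSq A := by
  have h : spectralNorm₂ A ≤ √(frobeniusSq A) := by
    refine ContinuousLinearMap.opNorm_le_bound _ (Real.sqrt_nonneg _) fun v => ?_
    refine abs_le_of_sq_le_sq' ?_ (by positivity) |>.2
    rw [mul_pow, Real.sq_sqrt (frobeniusSq_nonneg A)]
    exact norm_toEuclideanLin_sq_le A v
  calc spectralNorm₂ A ^ 2 ≤ √(frobeniusSq A) ^ 2 :=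
        pow_le_pow_left₀ (spectralNorm₂_nonneg A) h 2
    _ = frobeniusSq A := Real.sq_sqrt (frobeniusSq_nonneg A)

lemma frobeniusSq_eq_trace {m n : ℕ} (A : Matrix (Fin m) (Fin n) ℝ) :
    frobeniusSq A = (A * Aᵀ).trace := by
  simp [frobeniusSq, Matrix.trace, Matrix.mul_apply, sq]

/-- In a C⋆-algebra the norm of a self-adjoint element is multiplicative on powers; only the
nontrivial inequality is needed. It follows from the case of exponents `2 ^ j`. -/
lemma IsSelfAdjoint.norm_pow_le {E : Type*} [NormedRing E] [StarRing E] [CStarRing E] {x : E}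
    (hx : IsSelfAdjoint x) {n : ℕ} (hn : n ≠ 0) : ‖x‖ ^ n ≤ ‖x ^ n‖ := by
  rcases eq_or_ne x 0 with rfl | h0
  · simp [hn]
  have hpos : 0 < ‖x‖ := norm_pos_iff.2 h0
  have hlt : n < 2 ^ n := Nat.lt_two_pow_self
  have h1 : ‖x‖ ^ (2 ^ n) = ‖x ^ (2 ^ n)‖ := (hx.norm_pow_two_pow n).symm
  have hs : 2 ^ n = n + (2 ^ n - n) := by omega
  have h2 : ‖x‖ ^ n * ‖x‖ ^ (2 ^ n - n) ≤ ‖x ^ n‖ * ‖x‖ ^ (2 ^ n - n) := by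
    calc ‖x‖ ^ n * ‖x‖ ^ (2 ^ n - n) = ‖x‖ ^ (2 ^ n) := by rw [← pow_add, ← hs]
      _ = ‖x ^ n * x ^ (2 ^ n - n)‖ := by rw [h1, ← pow_add, ← hs]
      _ ≤ ‖x ^ n‖ * ‖x ^ (2 ^ n - n)‖ := norm_mul_le _ _
      _ ≤ ‖x ^ n‖ * ‖x‖ ^ (2 ^ n - n) := by
        gcongr
        exact norm_pow_le' _ (by omega)
  exact le_of_mul_le_mul_right h2 (by positivity)

lemma spectralNorm₂_pow_le_trace {m n : ℕ} (A : Matrix (Fin m) (Fin n) ℝ) {j : ℕ} (hj : j ≠ 0) :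
    spectralNorm₂ A ^ (4 * j) ≤ ((A * Aᵀ) ^ (2 * j)).trace := by
  have hsa : IsSelfAdjoint (A * Aᵀ) := by
    rw [← Matrix.conjTranspose_eq_transpose_of_trivial]
    exact Matrix.isHermitian_mul_conjTranspose_self A
  have hn : ‖A * Aᵀ‖ = spectralNorm₂ A ^ 2 := by
    rw [← Matrix.conjTranspose_eq_transpose_of_trivial]
    have := Matrix.l2_opNorm_conjTranspose_mul_self (Aᴴ)
    rw [Matrix.conjTranspose_conjTranspose, Matrix.l2_opNorm_conjTranspose] at this
    rw [this, sq, spectralNorm₂_eq_norm]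
  have ht : ((A * Aᵀ) ^ j)ᵀ = (A * Aᵀ) ^ j := by
    rw [Matrix.transpose_pow, Matrix.transpose_mul, Matrix.transpose_transpose]
  calc spectralNorm₂ A ^ (4 * j) = (‖A * Aᵀ‖ ^ j) ^ 2 := by rw [hn]; ring
    _ ≤ ‖(A * Aᵀ) ^ j‖ ^ 2 := by
      gcongr
      exact hsa.norm_pow_le hj
    _ ≤ frobeniusSq ((A * Aᵀ) ^ j) := spectralNorm₂_sq_le_frobeniusSq _
    _ = ((A * Aᵀ) ^ (2 * j)).trace := by
      rw [frobeniusSq_eq_trace, ht, ← pow_add, two_mul]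

lemma abs_entry_le_spectralNorm₂ {m n : ℕ} (A : Matrix (Fin m) (Fin n) ℝ) (i : Fin m) (j : Fin n) :
    |A i j| ≤ spectralNorm₂ A := by
  have h1 := Matrix.l2_opNorm_mulVec A (EuclideanSpace.single j 1)
  have h2 : |A i j| ≤ ‖WithLp.toLp 2 (A *ᵥ (EuclideanSpace.single j (1 : ℝ)).ofLp)‖ := by
    have := PiLp.norm_apply_le (WithLp.toLp 2 (A *ᵥ (EuclideanSpace.single j (1 : ℝ)).ofLp)) i
    simpa using this
  simpa [spectralNorm₂_eq_norm] using h2.trans h1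

lemma trace_pow_le_spectralNorm₂_pow {m n : ℕ} (A : Matrix (Fin m) (Fin n) ℝ) {k : ℕ}
    (hk : k ≠ 0) : ((A * Aᵀ) ^ k).trace ≤ m * spectralNorm₂ A ^ (2 * k) := by
  have hn : ‖A * Aᵀ‖ ≤ spectralNorm₂ A ^ 2 := by
    have h := Matrix.l2_opNorm_mul A Aᵀ
    rw [← Matrix.conjTranspose_eq_transpose_of_trivial A, Matrix.l2_opNorm_conjTranspose] at h
    rw [sq, spectralNorm₂_eq_norm, ← Matrix.conjTranspose_eq_transpose_of_trivial A]
    exact h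
  have hd : ∀ i, ((A * Aᵀ) ^ k) i i ≤ spectralNorm₂ A ^ (2 * k) := fun i =>
    calc ((A * Aᵀ) ^ k) i i ≤ ‖(A * Aᵀ) ^ k‖ :=
          (le_abs_self _).trans (abs_entry_le_spectralNorm₂ _ i i)
      _ ≤ ‖A * Aᵀ‖ ^ k := norm_pow_le' _ (Nat.pos_of_ne_zero hk)
      _ ≤ spectralNorm₂ A ^ (2 * k) := by
        rw [pow_mul]
        gcongr
  calc ((A * Aᵀ) ^ k).trace ≤ ∑ _i : Fin m, spectralNorm₂ A ^ (2 * k) :=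
        Finset.sum_le_sum fun i _ => hd i
    _ = m * spectralNorm₂ A ^ (2 * k) := by simp

end SpectralNorm

/-! ### Closed walks -/

section Walks

open scoped Matrix

/-- Entries of matrix powers as sums over walks with prescribed endpoints. -/
lemma Matrix.pow_succ_apply_eq_sum {R : Type*} [Fintype R] [DecidableEq R] (B : Matrix R R ℝ)
    (k : ℕ) (a b : R) :
    (B ^ (k + 1)) a b = ∑ x : Fin k → R, ∏ i : Fin (k + 1),
      B ((Fin.cons a x : Fin (k + 1) → R) i) ((Fin.snoc x b : Fin (k + 1) → R) i) := by
  induction k generalizing a with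
  | zero => simp [Fin.snoc]
  | succ k ih =>
    rw [pow_succ', Matrix.mul_apply, ← (Fin.consEquiv fun _ => R).sum_comp, Fintype.sum_prod_type]
    refine Finset.sum_congr rfl fun c _ => ?_
    rw [ih, Finset.mul_sum]
    refine Finset.sum_congr rfl fun x _ => ?_
    have hc : Fin.consEquiv (fun _ => R) (c, x) = (Fin.cons c x : Fin (k + 1) → R) := rfl
    have hs : (Fin.snoc (Fin.cons c x : Fin (k + 1) → R) b : Fin (k + 2) → R)
        = Fin.cons c (Fin.snoc x b : Fin (k + 1) → R) := (Fin.cons_snoc_eq_snoc_cons _ _ _).symm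
    rw [hc, hs, Fin.prod_univ_succ (n := k + 1)]
    simp only [Fin.cons_zero, Fin.cons_succ]

lemma Matrix.trace_pow_succ_eq_sum {R : Type*} [Fintype R] [DecidableEq R] (B : Matrix R R ℝ)
    (k : ℕ) :
    (B ^ (k + 1)).trace = ∑ x : Fin (k + 1) → R, ∏ i, B (x i) (x (finRotate _ i)) := by
  rw [← (Fin.consEquiv fun _ => R).sum_comp, Fintype.sum_prod_type, Matrix.trace]
  refine Finset.sum_congr rfl fun a _ => ?_
  rw [Matrix.diag_apply, Matrix.pow_succ_apply_eq_sum]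
  refine Finset.sum_congr rfl fun x _ => Finset.prod_congr rfl fun i _ => ?_
  rw [Fin.snoc_eq_cons_rotate]
  rfl

/-- The row index, in a closed walk of length `2k` on a bipartite graph, of the step `s`: the
steps are `x i → y i` (left summand) and `y i → x (i + 1)` (right summand), where `i + 1` is
cyclic. -/
def stepRow {k : ℕ} (s : Fin k ⊕ Fin k) : Fin k := s.elim id (finRotate k)

/-- The column index of the step `s`, see `stepRow`. -/
def stepCol {k : ℕ} (s : Fin k ⊕ Fin k) : Fin k := s.elim id id

lemma trace_pow_eq_sum_walks {m n : ℕ} (A : Matrix (Fin m) (Fin n) ℝ) {k : ℕ} (hk : k ≠ 0) :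
    ((A * Aᵀ) ^ k).trace = ∑ x : Fin k → Fin m, ∑ y : Fin k → Fin n,
      ∏ s : Fin k ⊕ Fin k, A (x (stepRow s)) (y (stepCol s)) := by
  obtain ⟨k, rfl⟩ := Nat.exists_eq_succ_of_ne_zero hk
  rw [Matrix.trace_pow_succ_eq_sum]
  refine Finset.sum_congr rfl fun x _ => ?_
  simp only [Matrix.mul_apply, Matrix.transpose_apply]
  rw [Finset.prod_univ_sum, Fintype.piFinset_univ]
  refine Finset.sum_congr rfl fun y _ => ?_
  rw [Fintype.prod_sum_type, ← Finset.prod_mul_distrib]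
  rfl

end Walks

/-! ### Patterns of walks -/

section Patterns

/-- The step `s` of the closed walk with rows `x` and columns `y` traverses the edge
`(x (stepRow s), y (stepCol s))` of the complete bipartite graph. -/
def walkEdge {k : ℕ} {R C : Type*} (x : Fin k → R) (y : Fin k → C) (s : Fin k ⊕ Fin k) : R × C :=
  (x (stepRow s), y (stepCol s))

open Classical in
/-- Every edge traversed by a walk is traversed an even number of times. Which steps traverse the
same edge depends only on the equalities among the rows and among the columns of the walk, that is,
on the kernels `π` and `ρ` of these two maps. -/
def EvenPattern {k : ℕ} (π ρ : Setoid (Fin k)) : Prop :=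
  ∀ s₀ : Fin k ⊕ Fin k, Even (Finset.univ.filter fun s : Fin k ⊕ Fin k =>
    π (stepRow s) (stepRow s₀) ∧ ρ (stepCol s) (stepCol s₀)).card

lemma evenPattern_ker_iff {k : ℕ} {R C : Type*} [DecidableEq R] [DecidableEq C]
    (x : Fin k → R) (y : Fin k → C) :
    EvenPattern (Setoid.ker x) (Setoid.ker y) ↔
      ∀ e : R × C, Even (Finset.univ.filter fun s => walkEdge x y s = e).card := by
  have key : ∀ s₀ : Fin k ⊕ Fin k, (Finset.univ.filter fun s : Fin k ⊕ Fin k =>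
      Setoid.ker x (stepRow s) (stepRow s₀) ∧ Setoid.ker y (stepCol s) (stepCol s₀))
        = Finset.univ.filter fun s => walkEdge x y s = walkEdge x y s₀ := by
    intro s₀
    ext s
    simp [Setoid.ker_def, walkEdge]
  constructor
  · intro h e
    by_cases he : ∃ s₀, walkEdge x y s₀ = e
    · obtain ⟨s₀, rfl⟩ := he
      have := h s₀
      convert this using 2
      exact (key s₀).symm.trans (by congr)
    · push Not at he
      rw [Finset.filter_false_of_mem fun s _ => he s]
      simp
  · intro h s₀
    convert h (walkEdge x y s₀) using 2
    exact Eq.trans (by congr) (key s₀)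

/-- A connected graph has at most one vertex more than it has edges: along a walk, every step to a
new vertex uses a new edge. -/
lemma card_image_prefix_le {R C : Type*} [DecidableEq R] [DecidableEq C] (x : ℕ → R) (y : ℕ → C)
    (l : ℕ) :
    ((Finset.range (l + 1)).image x).card + ((Finset.range (l + 1)).image y).card ≤
      ((Finset.range (l + 1)).image (fun i => (x i, y i)) ∪
        (Finset.range l).image (fun i => (x (i + 1), y i))).card + 1 := by
  induction l with
  | zero => simp
  | succ l ih =>
    set U := (Finset.range (l + 1)).image x
    set V := (Finset.range (l + 1)).image y
    set E := (Finset.range (l + 1)).image (fun i => (x i, y i)) ∪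
        (Finset.range l).image (fun i => (x (i + 1), y i)) with hE
    have hEU : ∀ e ∈ E, e.1 ∈ U ∧ e.2 ∈ V := by
      intro e he
      simp only [hE, Finset.mem_union, Finset.mem_image, Finset.mem_range, U, V] at he ⊢
      rcases he with ⟨i, hi, rfl⟩ | ⟨i, hi, rfl⟩
      · exact ⟨⟨i, hi, rfl⟩, ⟨i, hi, rfl⟩⟩
      · exact ⟨⟨i + 1, by omega, rfl⟩, ⟨i, by omega, rfl⟩⟩
    have e1 : (Finset.range (l + 1 + 1)).image x = insert (x (l + 1)) U := by
      rw [Finset.range_add_one, Finset.image_insert]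
    have e2 : (Finset.range (l + 1 + 1)).image y = insert (y (l + 1)) V := by
      rw [Finset.range_add_one, Finset.image_insert]
    have e3 : (Finset.range (l + 1 + 1)).image (fun i => (x i, y i)) ∪
        (Finset.range (l + 1)).image (fun i => (x (i + 1), y i))
        = insert (x (l + 1), y (l + 1)) (insert (x (l + 1), y l) E) := by
      rw [Finset.range_add_one (n := l + 1), Finset.image_insert,
        Finset.range_add_one (n := l), Finset.image_insert (a := l)
          (f := fun i => (x (i + 1), y i)), ← Finset.range_add_one (n := l), hE]
      ext e
      simp only [Finset.mem_union, Finset.mem_insert]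
      tauto
    rw [e1, e2, e3]
    have hU : (insert (x (l + 1)) U).card ≤ U.card + if x (l + 1) ∈ U then 0 else 1 := by
      split_ifs with h
      · rw [Finset.insert_eq_of_mem h]; omega
      · rw [Finset.card_insert_of_notMem h]
    have hV : (insert (y (l + 1)) V).card ≤ V.card + if y (l + 1) ∈ V then 0 else 1 := by
      split_ifs with h
      · rw [Finset.insert_eq_of_mem h]; omega
      · rw [Finset.card_insert_of_notMem h]
    have hE1 : E.card + (if x (l + 1) ∈ U then 0 else 1) ≤ (insert (x (l + 1), y l) E).card := by
      by_cases h : x (l + 1) ∈ U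
      · rw [if_pos h, add_zero]
        exact Finset.card_le_card (Finset.subset_insert _ _)
      · rw [if_neg h, Finset.card_insert_of_notMem fun h' => h (hEU _ h').1]
    have hE2 : (insert (x (l + 1), y l) E).card + (if y (l + 1) ∈ V then 0 else 1) ≤
        (insert (x (l + 1), y (l + 1)) (insert (x (l + 1), y l) E)).card := by
      by_cases h : y (l + 1) ∈ V
      · rw [if_pos h, add_zero]
        exact Finset.card_le_card (Finset.subset_insert _ _)
      · have hnew : (x (l + 1), y (l + 1)) ∉ insert (x (l + 1), y l) E := by
          intro h'
          rcases Finset.mem_insert.1 h' with h' | h'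
          · refine h ?_
            rw [(Prod.mk.inj h').2]
            exact Finset.mem_image_of_mem _ (Finset.self_mem_range_succ l)
          · exact h (hEU _ h').2
        rw [if_neg h, Finset.card_insert_of_notMem hnew]
    omega

lemma card_image_add_card_image_le {k : ℕ} {R C : Type*} [DecidableEq R] [DecidableEq C]
    (x : Fin k → R) (y : Fin k → C) :
    (Finset.univ.image x).card + (Finset.univ.image y).card ≤
      (Finset.univ.image (walkEdge x y)).card + 1 := by
  cases k with
  | zero => simp
  | succ l =>
    have hx : (Finset.range (l + 1)).image (fun i => x (Fin.ofNat (l + 1) i))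
        = Finset.univ.image x := by
      ext a
      simp only [Finset.mem_image, Finset.mem_range, Finset.mem_univ, true_and]
      exact ⟨fun ⟨i, _, h⟩ => ⟨_, h⟩, fun ⟨i, h⟩ => ⟨i, i.2, by simpa using h⟩⟩
    have hy : (Finset.range (l + 1)).image (fun i => y (Fin.ofNat (l + 1) i))
        = Finset.univ.image y := by
      ext a
      simp only [Finset.mem_image, Finset.mem_range, Finset.mem_univ, true_and]
      exact ⟨fun ⟨i, _, h⟩ => ⟨_, h⟩, fun ⟨i, h⟩ => ⟨i, i.2, by simpa using h⟩⟩
    have h := card_image_prefix_le (fun i => x (Fin.ofNat (l + 1) i))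
      (fun i => y (Fin.ofNat (l + 1) i)) l
    rw [hx, hy] at h
    refine h.trans (Nat.add_le_add_right (Finset.card_le_card ?_) 1)
    intro e he
    simp only [Finset.mem_union, Finset.mem_image, Finset.mem_range, Finset.mem_univ,
      true_and] at he ⊢
    rcases he with ⟨i, hi, rfl⟩ | ⟨i, hi, rfl⟩
    · exact ⟨Sum.inl (Fin.ofNat (l + 1) i), rfl⟩
    · refine ⟨Sum.inr (Fin.ofNat (l + 1) i), ?_⟩
      have : finRotate (l + 1) (Fin.ofNat (l + 1) i) = Fin.ofNat (l + 1) (i + 1) := by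
        ext
        rw [coe_finRotate_of_ne_last]
        · simp [Nat.mod_eq_of_lt (show i < l + 1 by omega),
            Nat.mod_eq_of_lt (show i + 1 < l + 1 by omega)]
        · intro hc
          have := congrArg Fin.val hc
          simp [Nat.mod_eq_of_lt (show i < l + 1 by omega)] at this
          omega
      simp only [walkEdge, stepRow, stepCol, Sum.elim_inr, this, id]

instance {k : ℕ} : Finite (Setoid (Fin k)) :=
  Finite.of_injective (fun π : Setoid (Fin k) => fun a b => π a b) fun _ _ h =>
    Setoid.ext fun a b => iff_of_eq (congrFun (congrFun h a) b)

open Classical in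
/-- There are at most `|R| ^ q` maps into `R` with a given kernel, if the kernel has `q`
classes. -/
lemma card_filter_ker_eq_le {k : ℕ} {R : Type*} [Fintype R] (π : Setoid (Fin k)) :
    (Finset.univ.filter fun x : Fin k → R => Setoid.ker x = π).card ≤
      Fintype.card R ^ Fintype.card (Quotient π) := by
  rw [← Fintype.card_fun, ← Fintype.card_subtype]
  refine Fintype.card_le_of_injective
    (fun x : {x : Fin k → R // Setoid.ker x = π} => fun q : Quotient π => x.1 q.out) ?_
  rintro ⟨x, hx⟩ ⟨x', hx'⟩ h
  ext i
  have key : ∀ z : Fin k → R, Setoid.ker z = π → z (Quotient.mk π i).out = z i := by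
    rintro z rfl
    exact Setoid.ker_def.1 (Quotient.mk_out (s := Setoid.ker z) i)
  have := congrFun h (Quotient.mk π i)
  simp only [key x hx, key x' hx'] at this
  exact this

open Classical in
/-- The maps into `Fin r` with a given kernel are the injections on its classes. -/
lemma le_card_filter_ker_eq {k r : ℕ} (π : Setoid (Fin k)) :
    (r - k) ^ Fintype.card (Quotient π) ≤
      (Finset.univ.filter fun x : Fin k → Fin r => Setoid.ker x = π).card := by
  have hq : Fintype.card (Quotient π) ≤ k := by
    simpa using Fintype.card_quotient_le π
  calc (r - k) ^ Fintype.card (Quotient π)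
      ≤ (r + 1 - Fintype.card (Quotient π)) ^ Fintype.card (Quotient π) :=
        Nat.pow_le_pow_left (by omega) _
    _ ≤ r.descFactorial (Fintype.card (Quotient π)) := Nat.pow_sub_le_descFactorial _ _
    _ = Fintype.card (Quotient π ↪ Fin r) := by rw [Fintype.card_embedding_eq, Fintype.card_fin]
    _ ≤ _ := by
      rw [← Fintype.card_subtype]
      refine Fintype.card_le_of_injective
        (fun e : Quotient π ↪ Fin r => (⟨fun i => e (Quotient.mk π i), ?_⟩ :
          {x : Fin k → Fin r // Setoid.ker x = π})) ?_
      · ext i j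
        rw [Setoid.ker_def, e.injective.eq_iff]
        exact Quotient.eq
      · intro e e' h
        ext q
        induction q using Quotient.inductionOn with
        | h i => exact congrArg Fin.val (congrFun (congrArg Subtype.val h) i)

lemma card_quotient_ker {k : ℕ} {R : Type*} [DecidableEq R] (x : Fin k → R)
    [Fintype (Quotient (Setoid.ker x))] :
    Fintype.card (Quotient (Setoid.ker x)) = (Finset.univ.image x).card := by
  rw [Fintype.card_congr (Setoid.quotientKerEquivRange x), ← Set.toFinset_card, Set.toFinset_range]

/-- Comparison of walks in a large vertex set, penalised by a factor `s` for every vertex, with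
walks in a set of `r ≥ s |R| + k` vertices. -/
lemma sum_pow_card_image_mul_le {k r : ℕ} {R : Type*} [Fintype R] [DecidableEq R] {s : ℝ}
    (hs : 0 ≤ s) (hr : s * Fintype.card R + k ≤ r) (G : Setoid (Fin k) → ℝ) (hG : ∀ π, 0 ≤ G π) :
    ∑ x : Fin k → R, s ^ (Finset.univ.image x).card * G (Setoid.ker x) ≤
      ∑ x : Fin k → Fin r, G (Setoid.ker x) := by
  classical
  have : Fintype (Setoid (Fin k)) := Fintype.ofFinite _
  have hkr : k ≤ r := by
    have : (k : ℝ) ≤ r := le_trans (le_add_of_nonneg_left (by positivity)) hr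
    exact_mod_cast this
  rw [← Finset.sum_fiberwise Finset.univ (fun x : Fin k → R => Setoid.ker x),
    ← Finset.sum_fiberwise Finset.univ (fun x : Fin k → Fin r => Setoid.ker x)]
  refine Finset.sum_le_sum fun π _ => ?_
  set q := Fintype.card (Quotient π) with hq
  have h1 : ∑ x : Fin k → R with Setoid.ker x = π, s ^ (Finset.univ.image x).card *
      G (Setoid.ker x) = (Finset.univ.filter fun x : Fin k → R => Setoid.ker x = π).card *
        (s ^ q * G π) := by
    rw [← nsmul_eq_mul, ← Finset.sum_const]
    refine Finset.sum_congr rfl fun x hx => ?_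
    have hx : Setoid.ker x = π := (Finset.mem_filter.1 hx).2
    subst hx
    rw [hq, card_quotient_ker]
  have h2 : ∑ x : Fin k → Fin r with Setoid.ker x = π, G (Setoid.ker x)
      = (Finset.univ.filter fun x : Fin k → Fin r => Setoid.ker x = π).card * G π := by
    rw [← nsmul_eq_mul, ← Finset.sum_const]
    refine Finset.sum_congr rfl fun x hx => ?_
    rw [(Finset.mem_filter.1 hx).2]
  rw [h1, h2, ← mul_assoc]
  refine mul_le_mul_of_nonneg_right ?_ (hG π)
  calc ((Finset.univ.filter fun x : Fin k → R => Setoid.ker x = π).card : ℝ) * s ^ q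
      ≤ (Fintype.card R : ℝ) ^ q * s ^ q := by
        gcongr
        exact_mod_cast card_filter_ker_eq_le π
    _ = (s * Fintype.card R) ^ q := by rw [mul_pow, mul_comm]
    _ ≤ ((r - k : ℕ) : ℝ) ^ q := by
        gcongr
        rw [Nat.cast_sub hkr]
        linarith
    _ ≤ _ := by exact_mod_cast le_card_filter_ker_eq π

open Classical in
/-- The number of closed walks of length `2k` in the complete bipartite graph on `r + r` vertices
that traverse every edge an even number of times. -/
noncomputable def evenWalkCount (k r : ℕ) : ℝ :=
  ∑ x : Fin k → Fin r, ∑ y : Fin k → Fin r,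
    if EvenPattern (Setoid.ker x) (Setoid.ker y) then 1 else 0

open Classical in
lemma sum_evenPattern_le {k r : ℕ} {R C : Type*} [Fintype R] [DecidableEq R] [Fintype C]
    [DecidableEq C] {s : ℝ} (hs : 0 ≤ s) (hR : s * Fintype.card R + k ≤ r)
    (hC : s * Fintype.card C + k ≤ r) :
    ∑ x : Fin k → R, ∑ y : Fin k → C, (if EvenPattern (Setoid.ker x) (Setoid.ker y) then
      s ^ ((Finset.univ.image x).card + (Finset.univ.image y).card) else 0) ≤
      evenWalkCount k r := by
  have h1 : ∀ π : Setoid (Fin k), ∑ y : Fin k → C, s ^ (Finset.univ.image y).card *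
      (if EvenPattern π (Setoid.ker y) then (1 : ℝ) else 0) ≤
      ∑ y : Fin k → Fin r, if EvenPattern π (Setoid.ker y) then (1 : ℝ) else 0 := fun π =>
    sum_pow_card_image_mul_le hs hC (fun ρ => if EvenPattern π ρ then 1 else 0)
      fun ρ => by split_ifs <;> simp
  calc _ = ∑ x : Fin k → R, s ^ (Finset.univ.image x).card *
        ∑ y : Fin k → C, s ^ (Finset.univ.image y).card *
          (if EvenPattern (Setoid.ker x) (Setoid.ker y) then (1 : ℝ) else 0) := by
        refine Finset.sum_congr rfl fun x _ => ?_
        rw [Finset.mul_sum]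
        refine Finset.sum_congr rfl fun y _ => ?_
        split_ifs <;> simp [pow_add]
    _ ≤ ∑ x : Fin k → R, s ^ (Finset.univ.image x).card *
        ∑ y : Fin k → Fin r, if EvenPattern (Setoid.ker x) (Setoid.ker y) then (1 : ℝ) else 0 := by
        gcongr with x
        exact h1 _
    _ ≤ evenWalkCount k r :=
        sum_pow_card_image_mul_le hs hR
          (fun π => ∑ y : Fin k → Fin r, if EvenPattern π (Setoid.ker y) then (1 : ℝ) else 0)
          fun π => Finset.sum_nonneg fun y _ => by split_ifs <;> simp

end Patterns

/-! ### Random sign matrices -/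

section Signs

open scoped Matrix Matrix.Norms.L2Operator

/-- The sign `±1` encoded by a Boolean. -/
def boolSign (b : Bool) : ℝ := if b then 1 else -1

/-- The matrix with the entries `±1` given by `ε`. -/
def signMatrix {m n : ℕ} (ε : Fin m × Fin n → Bool) : Matrix (Fin m) (Fin n) ℝ :=
  Matrix.of fun i j => boolSign (ε (i, j))

lemma prod_walk_eq_prod_pow {k m n : ℕ} (A : Matrix (Fin m) (Fin n) ℝ) (x : Fin k → Fin m)
    (y : Fin k → Fin n) :
    ∏ s : Fin k ⊕ Fin k, A (x (stepRow s)) (y (stepCol s)) =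
      ∏ e : Fin m × Fin n, A e.1 e.2 ^ (Finset.univ.filter fun s => walkEdge x y s = e).card := by
  refine (Finset.prod_fiberwise' Finset.univ (walkEdge x y) (fun e => A e.1 e.2)).symm.trans ?_
  simp only [Finset.prod_const]

lemma sum_prod_boolSign_pow {ι : Type*} [Fintype ι] [DecidableEq ι] (q : ι → ℕ) :
    ∑ ε : ι → Bool, ∏ e, boolSign (ε e) ^ q e =
      if ∀ e, Even (q e) then 2 ^ Fintype.card ι else 0 := by
  have h := Finset.prod_univ_sum (fun _ : ι => (Finset.univ : Finset Bool))
    (fun e b => boolSign b ^ q e)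
  rw [Fintype.piFinset_univ] at h
  rw [← h]
  have hb : ∀ e, ∑ b : Bool, boolSign b ^ q e = 1 + (-1) ^ q e := fun e => by
    simp [boolSign]
  simp only [hb]
  split_ifs with hq
  · simp [(hq _).neg_one_pow, Finset.prod_const, one_add_one_eq_two]
  · push Not at hq
    obtain ⟨e, he⟩ := hq
    refine Finset.prod_eq_zero (Finset.mem_univ e) ?_
    simp [(Nat.not_even_iff_odd.1 he).neg_one_pow]

/-- Summation over all sign matrices leaves only the even walks in the trace. -/
lemma sum_trace_signMatrix {k r : ℕ} (hk : k ≠ 0) :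
    ∑ ε : Fin r × Fin r → Bool, ((signMatrix ε * (signMatrix ε)ᵀ) ^ k).trace =
      2 ^ (r * r) * evenWalkCount k r := by
  simp_rw [trace_pow_eq_sum_walks _ hk]
  rw [Finset.sum_comm, evenWalkCount, Finset.mul_sum]
  refine Finset.sum_congr rfl fun x _ => ?_
  rw [Finset.sum_comm, Finset.mul_sum]
  refine Finset.sum_congr rfl fun y _ => ?_
  simp_rw [prod_walk_eq_prod_pow]
  have := sum_prod_boolSign_pow
    (fun e : Fin r × Fin r => (Finset.univ.filter fun s => walkEdge x y s = e).card)
  simp only [Fintype.card_prod, Fintype.card_fin] at this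
  simp only [signMatrix, Matrix.of_apply, Prod.mk.eta]
  rw [this]
  simp only [evenPattern_ker_iff]
  split_ifs <;> simp

lemma sum_exp_sum_boolSign_le {ι : Type*} [Fintype ι] [DecidableEq ι] (c : ι → ℝ) :
    ∑ ε : ι → Bool, Real.exp (∑ e, c e * boolSign (ε e)) ≤
      2 ^ Fintype.card ι * Real.exp ((∑ e, c e ^ 2) / 2) := by
  have h := Finset.prod_univ_sum (fun _ : ι => (Finset.univ : Finset Bool))
    (fun e b => Real.exp (c e * boolSign b))
  rw [Fintype.piFinset_univ] at h
  simp_rw [Real.exp_sum]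
  rw [← h, Finset.sum_div, Real.exp_sum, ← Finset.card_univ, ← Finset.prod_const,
    ← Finset.prod_mul_distrib]
  refine Finset.prod_le_prod (fun e _ => Finset.sum_nonneg fun b _ => (Real.exp_pos _).le)
    fun e _ => ?_
  have := Real.cosh_le_exp_half_sq (c e)
  rw [Real.cosh_eq] at this
  simp only [Fintype.sum_bool, boolSign, if_true, Bool.false_eq_true, if_false, mul_one, mul_neg]
  linarith

/-- Khintchine's inequality for even moments. -/
lemma sum_pow_sum_boolSign_le {ι : Type*} [Fintype ι] [DecidableEq ι] (c : ι → ℝ) {V : ℝ}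
    (hV : 0 ≤ V) (hc : ∑ e, c e ^ 2 ≤ V) {q : ℕ} (hq : q ≠ 0) :
    ∑ ε : ι → Bool, (∑ e, c e * boolSign (ε e)) ^ (2 * q) ≤
      2 ^ Fintype.card ι * (2 * (6 * q * V) ^ q) := by
  rcases hV.eq_or_lt with rfl | hV
  · have hc0 : ∀ e, c e = 0 := by
      intro e
      have := (Finset.sum_eq_zero_iff_of_nonneg (fun e _ => sq_nonneg (c e))).1
        (le_antisymm hc (Finset.sum_nonneg fun e _ => sq_nonneg (c e))) e (Finset.mem_univ e)
      exact pow_eq_zero_iff two_ne_zero |>.1 this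
    simp [hc0, hq]
  have hq' : (0 : ℝ) < q := by exact_mod_cast Nat.pos_of_ne_zero hq
  -- the exponent `l` optimises the exponential moment bound
  set l : ℝ := √(2 * q / V) with hl
  have hl2 : l ^ 2 = 2 * q / V := Real.sq_sqrt (by positivity)
  have hlpos : 0 < l := Real.sqrt_pos.2 (by positivity)
  have hfac : ((2 * q).factorial : ℝ) ≤ ((2 * q : ℝ) ^ 2) ^ q := by
    rw [← pow_mul]
    exact_mod_cast Nat.factorial_le_pow (2 * q)
  have hpt : ∀ S : ℝ, S ^ (2 * q) ≤
      (2 * q * V) ^ q * (Real.exp (l * S) + Real.exp (-l * S)) := by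
    intro S
    have h1 : |l * S| ^ (2 * q) / (2 * q).factorial ≤ Real.exp |l * S| :=
      Real.pow_div_factorial_le_exp _ (abs_nonneg _) _
    have h2 : Real.exp |l * S| ≤ Real.exp (l * S) + Real.exp (-l * S) := by
      rcases abs_cases (l * S) with ⟨h, _⟩ | ⟨h, _⟩ <;> rw [h]
      · linarith [Real.exp_pos (-l * S)]
      · rw [neg_mul]; linarith [Real.exp_pos (l * S)]
    have h3 : |l * S| ^ (2 * q) = (2 * q / V) ^ q * S ^ (2 * q) := by
      rw [(even_two_mul q).pow_abs, mul_pow, pow_mul l, hl2]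
    rw [h3, div_le_iff₀ (by positivity)] at h1
    have h4 : (2 * q / V : ℝ) ^ q * S ^ (2 * q) ≤
        (Real.exp (l * S) + Real.exp (-l * S)) * ((2 * q : ℝ) ^ 2) ^ q :=
      h1.trans (by gcongr)
    have h5 : (2 * q * V : ℝ) ^ q * (2 * q / V) ^ q = ((2 * q : ℝ) ^ 2) ^ q := by
      rw [← mul_pow]
      congr 1
      field_simp
    rw [← h5] at h4
    have h6 : (0 : ℝ) < (2 * q / V) ^ q := by positivity
    refine le_of_mul_le_mul_left ?_ h6
    linarith
  have hexp : ∀ t : ℝ, t ^ 2 = 2 * q / V → ∑ ε : ι → Bool,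
      Real.exp (t * ∑ e, c e * boolSign (ε e)) ≤ 2 ^ Fintype.card ι * 3 ^ q := by
    intro t ht
    have h := sum_exp_sum_boolSign_le fun e => t * c e
    simp only [mul_assoc] at h
    simp only [Finset.mul_sum]
    refine h.trans ?_
    gcongr
    calc Real.exp ((∑ e, (t * c e) ^ 2) / 2) ≤ Real.exp q := by
          rw [Real.exp_le_exp]
          simp only [mul_pow, ← Finset.mul_sum, ht]
          calc 2 * q / V * (∑ e, c e ^ 2) / 2 ≤ 2 * q / V * V / 2 := by gcongr
            _ = q := by field_simp
      _ = Real.exp 1 ^ q := by rw [← Real.exp_nat_mul, mul_one]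
      _ ≤ 3 ^ q := by
          gcongr
          exact Real.exp_one_lt_three.le
  calc ∑ ε : ι → Bool, (∑ e, c e * boolSign (ε e)) ^ (2 * q)
      ≤ ∑ ε : ι → Bool, (2 * q * V) ^ q * (Real.exp (l * ∑ e, c e * boolSign (ε e)) +
          Real.exp (-l * ∑ e, c e * boolSign (ε e))) := Finset.sum_le_sum fun ε _ => hpt _
    _ ≤ (2 * q * V) ^ q * (2 ^ Fintype.card ι * 3 ^ q + 2 ^ Fintype.card ι * 3 ^ q) := by
        rw [← Finset.mul_sum, Finset.sum_add_distrib]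
        gcongr
        · exact hexp l hl2
        · exact hexp (-l) (by rw [neg_sq, hl2])
    _ = 2 ^ Fintype.card ι * (2 * (6 * q * V) ^ q) := by
        rw [show (6 * q * V : ℝ) = 2 * q * V * 3 by ring, mul_pow _ (3 : ℝ)]
        ring

/-- The integer points of the ball of radius `√(7 r)` in dimension `r`. After division by `2 √r`
they contain a `1/4`-net of the unit ball. -/
noncomputable def integerBall (r : ℕ) : Finset (Fin r → ℤ) :=
  (Fintype.piFinset fun _ => Finset.Icc (-(7 * r : ℕ) : ℤ) (7 * r : ℕ)).filter
    fun n => ∑ i, n i ^ 2 ≤ 7 * r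

lemma int_abs_le_sq (z : ℤ) : |z| ≤ z ^ 2 :=
  Int.natCast_natAbs z ▸ Int.natAbs_le_self_sq z

lemma mem_integerBall {r : ℕ} {n : Fin r → ℤ} : n ∈ integerBall r ↔ ∑ i, n i ^ 2 ≤ 7 * r := by
  simp only [integerBall, Finset.mem_filter, Fintype.mem_piFinset, Finset.mem_Icc,
    and_iff_right_iff_imp]
  intro h i
  have h1 : n i ^ 2 ≤ 7 * r :=
    (Finset.single_le_sum (f := fun i => n i ^ 2) (fun i _ => sq_nonneg _)
      (Finset.mem_univ i)).trans h
  have h2 : |n i| ≤ n i ^ 2 := int_abs_le_sq _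
  push_cast
  exact abs_le.1 (h2.trans h1)

lemma sum_Icc_half_pow_natAbs_le (a : ℕ) :
    ∑ n ∈ Finset.Icc (-(a : ℤ)) a, (1 / 2 : ℝ) ^ n.natAbs ≤ 3 - 2 * (1 / 2) ^ a := by
  induction a with
  | zero => norm_num
  | succ a ih =>
    have : Finset.Icc (-((a + 1 : ℕ) : ℤ)) (a + 1 : ℕ) =
        insert (-((a + 1 : ℕ) : ℤ)) (insert ((a + 1 : ℕ) : ℤ) (Finset.Icc (-(a : ℤ)) a)) := by
      ext z
      simp only [Finset.mem_insert, Finset.mem_Icc]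
      omega
    rw [this, Finset.sum_insert, Finset.sum_insert, Int.natAbs_neg, Int.natAbs_natCast]
    · rw [pow_succ]
      linarith
    · simp only [Finset.mem_Icc]; omega
    · simp only [Finset.mem_insert, Finset.mem_Icc]; omega

lemma card_integerBall_le (r : ℕ) : ((integerBall r).card : ℝ) ≤ 384 ^ r := by
  have hw : ∀ n ∈ integerBall r, (1 : ℝ) ≤ 2 ^ (7 * r) * ∏ i, (1 / 2 : ℝ) ^ (n i).natAbs := by
    intro n hn
    have h1 : ∑ i, (n i).natAbs ≤ 7 * r := by
      have : ∑ i, ((n i).natAbs : ℤ) ≤ 7 * r :=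
        (Finset.sum_le_sum fun i _ => by
          rw [Int.natCast_natAbs]; exact int_abs_le_sq _).trans (mem_integerBall.1 hn)
      exact_mod_cast this
    rw [Finset.prod_pow_eq_pow_sum, one_div, inv_pow]
    rw [← div_eq_mul_inv, one_le_div (by positivity)]
    exact pow_le_pow_right₀ one_le_two h1
  calc ((integerBall r).card : ℝ) = ∑ n ∈ integerBall r, (1 : ℝ) := by simp
    _ ≤ ∑ n ∈ integerBall r, 2 ^ (7 * r) * ∏ i, (1 / 2 : ℝ) ^ (n i).natAbs :=
        Finset.sum_le_sum hw
    _ ≤ ∑ n ∈ Fintype.piFinset fun _ : Fin r => Finset.Icc (-(7 * r : ℕ) : ℤ) (7 * r : ℕ),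
          2 ^ (7 * r) * ∏ i, (1 / 2 : ℝ) ^ (n i).natAbs :=
        Finset.sum_le_sum_of_subset_of_nonneg (Finset.filter_subset _ _)
          fun n _ _ => by positivity
    _ = 2 ^ (7 * r) * ∏ _i : Fin r,
          ∑ n ∈ Finset.Icc (-(7 * r : ℕ) : ℤ) (7 * r : ℕ), (1 / 2 : ℝ) ^ n.natAbs := by
        rw [Finset.prod_univ_sum, Finset.mul_sum]
    _ ≤ 2 ^ (7 * r) * ∏ _i : Fin r, (3 : ℝ) := by
        gcongr with i
        refine (sum_Icc_half_pow_natAbs_le _).trans ?_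
        have : (0 : ℝ) < (1 / 2) ^ (7 * r) := by positivity
        linarith
    _ = 384 ^ r := by
        rw [Finset.prod_const, Finset.card_univ, Fintype.card_fin, pow_mul, ← mul_pow]
        norm_num

/-- Every vector of the unit ball is within `1/4` of a point of the rescaled integer ball. -/
lemma exists_integerBall_near {r : ℕ} (hr : r ≠ 0) (v : EuclideanSpace ℝ (Fin r)) (hv : ‖v‖ ≤ 1) :
    ∃ n ∈ integerBall r, ‖v - WithLp.toLp 2 (fun i => (n i : ℝ) / (2 * √r))‖ ≤ 1 / 4 := by
  have hr' : (0 : ℝ) < r := by exact_mod_cast Nat.pos_of_ne_zero hr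
  set h : ℝ := 2 * √r with hh
  have hpos : 0 < h := by positivity
  have hsq : h ^ 2 = 4 * r := by rw [hh, mul_pow, Real.sq_sqrt hr'.le]; norm_num
  set n : Fin r → ℤ := fun i => round (h * v i) with hn
  have hv2 : ∑ i, v i ^ 2 ≤ 1 := by
    have := EuclideanSpace.real_norm_sq_eq v
    rw [← this]
    nlinarith [norm_nonneg v]
  have hround : ∀ i, (h * v i - n i) ^ 2 ≤ 1 / 4 := fun i => by
    have := abs_sub_round (h * v i)
    nlinarith [abs_nonneg (h * v i - n i), sq_abs (h * v i - n i)]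
  refine ⟨n, mem_integerBall.2 ?_, ?_⟩
  · -- `n² ≤ (5/4) (h v)² + 5 (h v - n)²`, which sums to `(5/4) 4 r + (5/4) r ≤ 7 r`
    have h1 : ∀ i, (n i : ℝ) ^ 2 ≤ 5 * r * v i ^ 2 + 5 / 4 := fun i => by
      have h2 : (n i : ℝ) ^ 2 ≤ 5 / 4 * (h * v i) ^ 2 + 5 * (h * v i - n i) ^ 2 := by
        nlinarith [sq_nonneg (h * v i - 4 * (n i - h * v i)),
          sq_nonneg (h * v i + 4 * (h * v i - n i))]
      have h3 : (h * v i) ^ 2 = 4 * r * v i ^ 2 := by rw [mul_pow, hsq]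
      nlinarith [hround i]
    have h4 : (∑ i, (n i : ℝ) ^ 2) ≤ 7 * r :=
      calc (∑ i, (n i : ℝ) ^ 2) ≤ ∑ i, (5 * r * v i ^ 2 + 5 / 4) :=
            Finset.sum_le_sum fun i _ => h1 i
        _ = 5 * r * ∑ i, v i ^ 2 + r * (5 / 4) := by
            rw [Finset.sum_add_distrib, ← Finset.mul_sum]; simp
        _ ≤ 5 * r * 1 + r * (5 / 4) := by gcongr
        _ ≤ 7 * r := by linarith
    exact_mod_cast h4
  · refine abs_le_of_sq_le_sq' ?_ (by norm_num) |>.2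
    rw [EuclideanSpace.real_norm_sq_eq]
    have h1 : ∀ i, (v - WithLp.toLp 2 (fun i => (n i : ℝ) / h)) i ^ 2 ≤ 1 / (16 * r) := fun i => by
      have : (v - WithLp.toLp 2 (fun i => (n i : ℝ) / h)) i = (h * v i - n i) / h := by
        simp only [PiLp.sub_apply]
        field_simp
      rw [this, div_pow, hsq, div_le_div_iff₀ (by positivity) (by positivity)]
      nlinarith [hround i]
    calc _ ≤ ∑ _i : Fin r, 1 / (16 * (r : ℝ)) := Finset.sum_le_sum fun i _ => h1 i
      _ = (1 / 4) ^ 2 := by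
        rw [Finset.sum_const, Finset.card_univ, Fintype.card_fin, nsmul_eq_mul]
        field_simp
        norm_num

/-- The spectral norm is controlled by the bilinear form at integer vectors. -/
lemma exists_integerBall_norm_le {r : ℕ} (hr : r ≠ 0) (Y : Matrix (Fin r) (Fin r) ℝ) :
    ∃ a ∈ integerBall r, ∃ b ∈ integerBall r,
      r * spectralNorm₂ Y ≤ ∑ i, ∑ j, (a i : ℝ) * b j * Y i j := by
  have hr' : (0 : ℝ) < r := by exact_mod_cast Nat.pos_of_ne_zero hr
  set f : EuclideanSpace ℝ (Fin r) →L[ℝ] EuclideanSpace ℝ (Fin r) :=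
    LinearMap.toContinuousLinearMap (Matrix.toEuclideanLin Y) with hf
  have hfY : spectralNorm₂ Y = ‖f‖ := rfl
  rcases (norm_nonneg f).eq_or_lt with h0 | hpos
  · refine ⟨0, mem_integerBall.2 (by simp), 0, mem_integerBall.2 (by simp), ?_⟩
    simp [hfY, ← h0]
  obtain ⟨v, hv1, hv2⟩ := ContinuousLinearMap.exists_lt_apply_of_lt_opNorm f
    (show 15 / 16 * ‖f‖ < ‖f‖ by linarith)
  have hfv : 0 < ‖f v‖ := lt_trans (by positivity) hv2
  set u : EuclideanSpace ℝ (Fin r) := (‖f v‖)⁻¹ • f v with hu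
  have hu1 : ‖u‖ = 1 := by
    rw [hu, norm_smul, norm_inv, norm_norm, inv_mul_cancel₀ hfv.ne']
  have huv : inner ℝ u (f v) = ‖f v‖ := by
    rw [hu, inner_smul_left, real_inner_self_eq_norm_sq]
    simp only [conj_trivial]
    field_simp
  obtain ⟨a, ha, hau⟩ := exists_integerBall_near hr u hu1.le
  obtain ⟨b, hb, hbv⟩ := exists_integerBall_near hr v hv1.le
  set u' : EuclideanSpace ℝ (Fin r) := WithLp.toLp 2 (fun i => (a i : ℝ) / (2 * √r)) with hu'
  set v' : EuclideanSpace ℝ (Fin r) := WithLp.toLp 2 (fun i => (b i : ℝ) / (2 * √r)) with hv'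
  refine ⟨a, ha, b, hb, ?_⟩
  have hu'n : ‖u'‖ ≤ 5 / 4 := by
    have := norm_sub_le u (u - u')
    rw [sub_sub_cancel] at this
    linarith
  have e1 : inner ℝ u' (f v') = inner ℝ u (f v) - inner ℝ (u - u') (f v)
      - inner ℝ u' (f (v - v')) := by
    rw [map_sub, inner_sub_left, inner_sub_right]
    ring
  have e2 : inner ℝ (u - u') (f v) ≤ 1 / 4 * ‖f‖ :=
    calc inner ℝ (u - u') (f v) ≤ ‖u - u'‖ * ‖f v‖ := real_inner_le_norm _ _
      _ ≤ 1 / 4 * (‖f‖ * 1) := by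
        gcongr
        exact (f.le_opNorm v).trans (by gcongr)
      _ = 1 / 4 * ‖f‖ := by ring
  have e3 : inner ℝ u' (f (v - v')) ≤ 5 / 4 * (‖f‖ * (1 / 4)) :=
    calc inner ℝ u' (f (v - v')) ≤ ‖u'‖ * ‖f (v - v')‖ := real_inner_le_norm _ _
      _ ≤ 5 / 4 * (‖f‖ * (1 / 4)) := by
        gcongr
        exact (f.le_opNorm _).trans (by gcongr)
  -- `3 / 8 = 15 / 16 - 1 / 4 - 5 / 16`, and the factor `4 r` below turns it into at least `r`
  have e4 : 3 / 8 * ‖f‖ ≤ inner ℝ u' (f v') := by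
    rw [e1, huv]
    linarith
  have e5 : ∑ i, ∑ j, (a i : ℝ) * b j * Y i j = 4 * r * inner ℝ u' (f v') := by
    have : ∀ i, f v' i = ∑ j, Y i j * ((b j : ℝ) / (2 * √r)) := fun i => by
      simp [hf, Matrix.toLpLin_apply, Matrix.mulVec, dotProduct, hv']
    simp only [PiLp.inner_apply, this, hu', Finset.mul_sum, RCLike.inner_apply, conj_trivial,
      Finset.sum_mul]
    refine Finset.sum_congr rfl fun i _ => Finset.sum_congr rfl fun j _ => ?_
    have hs : √(r : ℝ) ^ 2 = r := Real.sq_sqrt hr'.le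
    have hs0 : √(r : ℝ) ≠ 0 := by positivity
    field_simp
    rw [hs]
    ring
  rw [e5, hfY]
  nlinarith

/-- Moments of order `2r` of the norm of an `r × r` random sign matrix, by a union bound over
integer vectors. -/
lemma sum_spectralNorm₂_signMatrix_pow_le {r : ℕ} (hr : r ≠ 0) :
    ∑ ε : Fin r × Fin r → Bool, spectralNorm₂ (signMatrix ε) ^ (2 * r) ≤
      2 ^ (r * r) * (10 ^ 8 * r) ^ r := by
  have hr' : (0 : ℝ) < r := by exact_mod_cast Nat.pos_of_ne_zero hr
  have hpt : ∀ ε : Fin r × Fin r → Bool, (r * spectralNorm₂ (signMatrix ε)) ^ (2 * r) ≤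
      ∑ ab ∈ integerBall r ×ˢ integerBall r,
        (∑ e : Fin r × Fin r, ((ab.1 e.1 : ℝ) * ab.2 e.2) * boolSign (ε e)) ^ (2 * r) := by
    intro ε
    obtain ⟨a, ha, b, hb, h⟩ := exists_integerBall_norm_le hr (signMatrix ε)
    have h1 : ∑ i, ∑ j, (a i : ℝ) * b j * signMatrix ε i j =
        ∑ e : Fin r × Fin r, ((a e.1 : ℝ) * b e.2) * boolSign (ε e) := by
      rw [Fintype.sum_prod_type]
      rfl
    rw [h1] at h
    refine (pow_le_pow_left₀ (mul_nonneg hr'.le (spectralNorm₂_nonneg _)) h _).trans ?_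
    exact Finset.single_le_sum (f := fun ab : (Fin r → ℤ) × (Fin r → ℤ) =>
      (∑ e : Fin r × Fin r, ((ab.1 e.1 : ℝ) * ab.2 e.2) * boolSign (ε e)) ^ (2 * r))
      (fun ab _ => (even_two_mul r).pow_nonneg _) (Finset.mk_mem_product ha hb)
  have hmom : ∀ ab ∈ integerBall r ×ˢ integerBall r, ∑ ε : Fin r × Fin r → Bool,
      (∑ e : Fin r × Fin r, ((ab.1 e.1 : ℝ) * ab.2 e.2) * boolSign (ε e)) ^ (2 * r) ≤
        2 ^ (r * r) * (2 * (6 * r * (7 * r) ^ 2) ^ r) := by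
    rintro ⟨a, b⟩ hab
    obtain ⟨ha, hb⟩ := Finset.mem_product.1 hab
    have ha : ∑ i, (a i : ℝ) ^ 2 ≤ 7 * r := by exact_mod_cast mem_integerBall.1 ha
    have hb : ∑ i, (b i : ℝ) ^ 2 ≤ 7 * r := by exact_mod_cast mem_integerBall.1 hb
    have hc : ∑ e : Fin r × Fin r, ((a e.1 : ℝ) * b e.2) ^ 2 ≤ (7 * r) ^ 2 := by
      rw [Fintype.sum_prod_type]
      simp only [mul_pow, ← Finset.mul_sum, ← Finset.sum_mul]
      rw [← mul_pow, sq]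
      exact mul_le_mul ha hb (Finset.sum_nonneg fun i _ => sq_nonneg _) (by positivity)
    have := sum_pow_sum_boolSign_le (fun e : Fin r × Fin r => (a e.1 : ℝ) * b e.2)
      (by positivity) hc hr
    simpa using this
  have hsum : (r : ℝ) ^ (2 * r) *
      ∑ ε : Fin r × Fin r → Bool, spectralNorm₂ (signMatrix ε) ^ (2 * r) ≤
      (r : ℝ) ^ (2 * r) * (2 ^ (r * r) * (10 ^ 8 * r) ^ r) := by
    calc (r : ℝ) ^ (2 * r) *
          ∑ ε : Fin r × Fin r → Bool, spectralNorm₂ (signMatrix ε) ^ (2 * r)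
        = ∑ ε : Fin r × Fin r → Bool, (r * spectralNorm₂ (signMatrix ε)) ^ (2 * r) := by
          rw [Finset.mul_sum]
          simp only [mul_pow]
      _ ≤ ∑ ab ∈ integerBall r ×ˢ integerBall r, ∑ ε : Fin r × Fin r → Bool,
            (∑ e : Fin r × Fin r, ((ab.1 e.1 : ℝ) * ab.2 e.2) * boolSign (ε e)) ^ (2 * r) := by
          rw [Finset.sum_comm]
          exact Finset.sum_le_sum fun ε _ => hpt ε
      _ ≤ ∑ _ab ∈ integerBall r ×ˢ integerBall r,
            (2 : ℝ) ^ (r * r) * (2 * (6 * r * (7 * r) ^ 2) ^ r) := Finset.sum_le_sum hmom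
      _ = ((integerBall r).card : ℝ) ^ 2 * (2 ^ (r * r) * (2 * (6 * r * (7 * r) ^ 2) ^ r)) := by
          rw [Finset.sum_const, Finset.card_product, nsmul_eq_mul]
          push_cast
          ring
      _ ≤ (384 ^ r) ^ 2 * (2 ^ (r * r) * (2 ^ r * (6 * r * (7 * r) ^ 2) ^ r)) := by
          gcongr
          · exact card_integerBall_le r
          · exact le_self_pow₀ one_le_two hr
      _ = 2 ^ (r * r) * (384 ^ 2 * 2 * (6 * r * (7 * r) ^ 2)) ^ r := by
          rw [mul_pow (384 ^ 2 * 2 : ℝ), mul_pow (384 ^ 2 : ℝ), pow_right_comm]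
          ring
      _ ≤ 2 ^ (r * r) * (r ^ 2 * (10 ^ 8 * r)) ^ r := by
          -- `384² · 2 · 6 · 7² ≤ 10⁸`
          gcongr ?_ * ?_ ^ r
          nlinarith [pow_pos hr' 3]
      _ = (r : ℝ) ^ (2 * r) * (2 ^ (r * r) * (10 ^ 8 * r) ^ r) := by
          rw [mul_pow, ← pow_mul]
          ring
  exact le_of_mul_le_mul_left hsum (by positivity)

/-- For `k ≤ r` the even walks are counted through `tr (Y Yᵀ) ^ k ≤ r ‖Y‖ ^ (2k)`, and the moments
of `‖Y‖` of order `2k` through those of order `2r`. -/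
lemma evenWalkCount_le {k r : ℕ} (hk : k ≠ 0) (hkr : k ≤ r) :
    evenWalkCount k r ≤ 2 * r * (10 ^ 8 * r) ^ k := by
  have hr : r ≠ 0 := by omega
  have hr' : (0 : ℝ) < r := by exact_mod_cast Nat.pos_of_ne_zero hr
  set D : ℝ := 10 ^ 8 * r with hD
  have hDpos : 0 < D := by positivity
  have hpt : ∀ a : ℝ, 0 ≤ a → a ^ (2 * k) ≤ D ^ k * (1 + a ^ (2 * r) / D ^ r) := by
    intro a ha
    rw [pow_mul, pow_mul, ← div_pow]
    have hb : 0 ≤ a ^ 2 / D := by positivity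
    have : (a ^ 2) ^ k = D ^ k * (a ^ 2 / D) ^ k := by
      rw [← mul_pow, mul_div_cancel₀ _ hDpos.ne']
    rw [this]
    gcongr
    rcases le_total (a ^ 2 / D) 1 with h | h
    · exact (pow_le_one₀ hb h).trans (le_add_of_nonneg_right (by positivity))
    · exact (pow_le_pow_right₀ h hkr).trans (le_add_of_nonneg_left zero_le_one)
  have h2 : (0 : ℝ) < 2 ^ (r * r) := by positivity
  refine le_of_mul_le_mul_left ?_ h2
  rw [← sum_trace_signMatrix hk]
  calc ∑ ε : Fin r × Fin r → Bool, ((signMatrix ε * (signMatrix ε)ᵀ) ^ k).trace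
      ≤ ∑ ε : Fin r × Fin r → Bool,
          r * (D ^ k * (1 + spectralNorm₂ (signMatrix ε) ^ (2 * r) / D ^ r)) := by
        refine Finset.sum_le_sum fun ε _ => (trace_pow_le_spectralNorm₂_pow _ hk).trans ?_
        gcongr
        exact hpt _ (spectralNorm₂_nonneg _)
    _ = r * (D ^ k * (2 ^ (r * r) +
          (∑ ε : Fin r × Fin r → Bool, spectralNorm₂ (signMatrix ε) ^ (2 * r)) / D ^ r)) := by
        rw [← Finset.mul_sum, ← Finset.mul_sum, Finset.sum_add_distrib, ← Finset.sum_div]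
        simp
    _ ≤ r * (D ^ k * (2 ^ (r * r) + 2 ^ (r * r) * D ^ r / D ^ r)) := by
        gcongr
        exact sum_spectralNorm₂_signMatrix_pow_le hr
    _ = 2 ^ (r * r) * (2 * r * D ^ k) := by
        field_simp
        ring

end Signs

/-! ### Random matrices with independent entries -/

section TraceMoments

open scoped Matrix

/-- The matrix with the given family of entries. -/
def matOf {m n : ℕ} (z : Fin m × Fin n → ℝ) : Matrix (Fin m) (Fin n) ℝ :=
  Matrix.of fun i j => z (i, j)

lemma continuous_matOf {m n : ℕ} :
    Continuous (matOf : (Fin m × Fin n → ℝ) → Matrix (Fin m) (Fin n) ℝ) :=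
  continuous_matrix fun i j => continuous_apply (i, j)

lemma sum_card_walkEdge {k m n : ℕ} (x : Fin k → Fin m) (y : Fin k → Fin n) :
    ∑ e : Fin m × Fin n, (Finset.univ.filter fun s => walkEdge x y s = e).card = 2 * k := by
  rw [← Finset.card_eq_sum_card_fiberwise fun _ _ => Finset.mem_coe.2 (Finset.mem_univ _)]
  simp [two_mul]

variable {m n : ℕ} (ν : Fin m × Fin n → Measure ℝ) [∀ e, IsProbabilityMeasure (ν e)]

lemma integrable_walk (hint : ∀ e q, Integrable (fun x : ℝ => x ^ q) (ν e)) {k : ℕ}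
    (x : Fin k → Fin m) (y : Fin k → Fin n) :
    Integrable (fun z => ∏ s : Fin k ⊕ Fin k, matOf z (x (stepRow s)) (y (stepCol s)))
      (Measure.pi ν) := by
  simp_rw [prod_walk_eq_prod_pow]
  exact Integrable.fintype_prod_dep fun e => hint e _

open Classical in
/-- The contribution of one closed walk to the expected trace. If some edge is traversed an odd
number of times, it vanishes. Otherwise every distinct edge contributes a factor `s`, and there are
at least as many edges as vertices, minus one. -/
lemma integral_walk_le (hodd : ∀ e q, Odd q → ∫ x, x ^ q ∂(ν e) = 0) {k : ℕ} {s K : ℝ}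
    (hs : 0 < s) (hs1 : s ≤ 1) (hK : 0 ≤ K)
    (heven : ∀ e q, 1 ≤ q → q ≤ k → ∫ x, x ^ (2 * q) ∂(ν e) ≤ s * K ^ q)
    (x : Fin k → Fin m) (y : Fin k → Fin n) :
    ∫ z, ∏ t : Fin k ⊕ Fin k, matOf z (x (stepRow t)) (y (stepCol t)) ∂(Measure.pi ν) ≤
      K ^ k / s * if EvenPattern (Setoid.ker x) (Setoid.ker y) then
        s ^ ((Finset.univ.image x).card + (Finset.univ.image y).card) else 0 := by
  set q : Fin m × Fin n → ℕ := fun e => (Finset.univ.filter fun t => walkEdge x y t = e).card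
    with hq
  have hprod : ∫ z, ∏ t : Fin k ⊕ Fin k, matOf z (x (stepRow t)) (y (stepCol t)) ∂(Measure.pi ν)
      = ∏ e, ∫ u, u ^ q e ∂(ν e) := by
    simp_rw [prod_walk_eq_prod_pow]
    exact integral_fintype_prod_eq_prod (𝕜 := ℝ) (μ := ν) fun e u => u ^ q e
  rw [hprod]
  split_ifs with hE
  · rw [evenPattern_ker_iff] at hE
    have hsum : ∑ e, q e / 2 = k := by
      have h2 : ∑ e, 2 * (q e / 2) = 2 * k := by
        rw [← sum_card_walkEdge x y]
        exact Finset.sum_congr rfl fun e _ => Nat.two_mul_div_two_of_even (hE e)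
      rw [← Finset.mul_sum] at h2
      omega
    have hle : ∀ e, q e / 2 ≤ k := fun e =>
      (Finset.single_le_sum (f := fun e => q e / 2) (fun _ _ => Nat.zero_le _)
        (Finset.mem_univ e)).trans hsum.le
    have hfac : ∀ e, ∫ u, u ^ q e ∂(ν e) ≤
        (if e ∈ Finset.univ.image (walkEdge x y) then s else 1) * K ^ (q e / 2) := by
      intro e
      have h2 : q e = 2 * (q e / 2) := (Nat.two_mul_div_two_of_even (hE e)).symm
      split_ifs with he
      · obtain ⟨t, _, ht⟩ := Finset.mem_image.1 he
        have hpos : 0 < q e := Finset.card_pos.2 ⟨t, by simp [ht]⟩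
        have := heven e (q e / 2) (by omega) (hle e)
        rwa [← h2] at this
      · have h0 : q e = 0 := by
          refine Finset.card_eq_zero.2 (Finset.filter_eq_empty_iff.2 fun t _ ht => he ?_)
          exact Finset.mem_image.2 ⟨t, Finset.mem_univ t, ht⟩
        simp [h0]
    have hnonneg : ∀ e, 0 ≤ ∫ u, u ^ q e ∂(ν e) := fun e =>
      integral_nonneg fun u => (hE e).pow_nonneg u
    have hcard := card_image_add_card_image_le x y
    calc ∏ e, ∫ u, u ^ q e ∂(ν e)
        ≤ ∏ e, (if e ∈ Finset.univ.image (walkEdge x y) then s else 1) * K ^ (q e / 2) :=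
          Finset.prod_le_prod (fun e _ => hnonneg e) fun e _ => hfac e
      _ = s ^ (Finset.univ.image (walkEdge x y)).card * K ^ k := by
          rw [Finset.prod_mul_distrib, Finset.prod_pow_eq_pow_sum, hsum, Finset.prod_ite_mem,
            Finset.univ_inter, Finset.prod_const]
      _ = K ^ k / s * s ^ ((Finset.univ.image (walkEdge x y)).card + 1) := by
          rw [pow_succ]
          field_simp
      _ ≤ _ := by
          have hKs : 0 ≤ K ^ k / s := by positivity
          exact mul_le_mul_of_nonneg_left (pow_le_pow_of_le_one hs.le hs1 hcard) hKs
  · rw [evenPattern_ker_iff] at hE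
    push Not at hE
    obtain ⟨e, he⟩ := hE
    rw [Finset.prod_eq_zero (Finset.mem_univ e) (hodd e _ (Nat.not_even_iff_odd.1 he)), mul_zero]

/-- Expected traces of powers, compared with those of a sign matrix of size about `s max(m, n)`. -/
lemma integral_trace_le (hint : ∀ e q, Integrable (fun x : ℝ => x ^ q) (ν e))
    (hodd : ∀ e q, Odd q → ∫ x, x ^ q ∂(ν e) = 0) {k r : ℕ} (hk : k ≠ 0) {s K : ℝ} (hs : 0 < s)
    (hs1 : s ≤ 1) (hK : 0 ≤ K)
    (heven : ∀ e q, 1 ≤ q → q ≤ k → ∫ x, x ^ (2 * q) ∂(ν e) ≤ s * K ^ q)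
    (hm : s * m + k ≤ r) (hn : s * n + k ≤ r) :
    Integrable (fun z => ((matOf z * (matOf z)ᵀ) ^ k).trace) (Measure.pi ν) ∧
    ∫ z, ((matOf z * (matOf z)ᵀ) ^ k).trace ∂(Measure.pi ν) ≤
      K ^ k / s * evenWalkCount k r := by
  classical
  simp_rw [trace_pow_eq_sum_walks _ hk]
  refine ⟨integrable_finsetSum _ fun x _ => integrable_finsetSum _ fun y _ =>
    integrable_walk ν hint x y, ?_⟩
  rw [integral_finsetSum _ fun x _ => integrable_finsetSum _ fun y _ => integrable_walk ν hint x y]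
  simp_rw [integral_finsetSum _ fun y _ => integrable_walk ν hint _ y]
  calc _ ≤ ∑ x : Fin k → Fin m, ∑ y : Fin k → Fin n, K ^ k / s *
        if EvenPattern (Setoid.ker x) (Setoid.ker y) then
          s ^ ((Finset.univ.image x).card + (Finset.univ.image y).card) else 0 :=
        Finset.sum_le_sum fun x _ => Finset.sum_le_sum fun y _ =>
          integral_walk_le ν hodd hs hs1 hK heven x y
    _ = K ^ k / s * ∑ x : Fin k → Fin m, ∑ y : Fin k → Fin n,
        if EvenPattern (Setoid.ker x) (Setoid.ker y) then
          s ^ ((Finset.univ.image x).card + (Finset.univ.image y).card) else 0 := by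
        simp only [Finset.mul_sum]
    _ ≤ K ^ k / s * evenWalkCount k r := by
        have hKs : 0 ≤ K ^ k / s := by positivity
        exact mul_le_mul_of_nonneg_left
          (sum_evenPattern_le hs.le (by simpa using hm) (by simpa using hn)) hKs

/-- The expected norm of a matrix with independent symmetric entries, whose even moments are those
of a sparse matrix. -/
lemma integral_spectralNorm₂_le (hint : ∀ e q, Integrable (fun x : ℝ => x ^ q) (ν e))
    (hodd : ∀ e q, Odd q → ∫ x, x ^ q ∂(ν e) = 0) {j k r : ℕ} (hj : j ≠ 0) (hkj : k = 2 * j)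
    {s K D : ℝ} (hs : 0 < s) (hs1 : s ≤ 1) (hK : 0 ≤ K)
    (heven : ∀ e q, 1 ≤ q → q ≤ k → ∫ x, x ^ (2 * q) ∂(ν e) ≤ s * K ^ q)
    (hm : s * m + k ≤ r) (hn : s * n + k ≤ r) (hD : 0 < D)
    (hD2 : D ^ 2 = Real.exp 1 * (K * (10 ^ 8 * r))) (hk : 2 * r / s ≤ Real.exp k) :
    Integrable (fun z => spectralNorm₂ (matOf z)) (Measure.pi ν) ∧
    ∫ z, spectralNorm₂ (matOf z) ∂(Measure.pi ν) ≤ 2 * D := by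
  have hk0 : k ≠ 0 := by omega
  have hkr : k ≤ r := by
    have : (k : ℝ) ≤ r := le_trans (le_add_of_nonneg_left (by positivity)) hm
    exact_mod_cast this
  obtain ⟨hi, hle⟩ := integral_trace_le ν hint hodd hk0 hs hs1 hK heven hm hn
  have hpt : ∀ z : Fin m × Fin n → ℝ, spectralNorm₂ (matOf z) ≤
      D * (1 + ((matOf z * (matOf z)ᵀ) ^ k).trace / D ^ (2 * k)) := by
    intro z
    have h1 : spectralNorm₂ (matOf z) ^ (2 * k) ≤ ((matOf z * (matOf z)ᵀ) ^ k).trace := by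
      have := spectralNorm₂_pow_le_trace (matOf z) hj
      rw [hkj]
      convert this using 2
      ring
    have h0 := spectralNorm₂_nonneg (matOf z)
    set a := spectralNorm₂ (matOf z)
    have h2 : a / D ≤ 1 + (a / D) ^ (2 * k) := by
      rcases le_total (a / D) 1 with h | h
      · exact h.trans (le_add_of_nonneg_right (by positivity))
      · exact (le_self_pow₀ h (by omega)).trans (le_add_of_nonneg_left zero_le_one)
    calc a = D * (a / D) := by field_simp
      _ ≤ D * (1 + (a / D) ^ (2 * k)) := by gcongr
      _ ≤ _ := by
        rw [div_pow]
        gcongr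
  have hiR : Integrable (fun z => D * (1 + ((matOf z * (matOf z)ᵀ) ^ k).trace / D ^ (2 * k)))
      (Measure.pi ν) := ((integrable_const _).add (hi.div_const _)).const_mul _
  have hiL : Integrable (fun z => spectralNorm₂ (matOf z)) (Measure.pi ν) := by
    refine hiR.mono' (continuous_spectralNorm₂.comp continuous_matOf).aestronglyMeasurable ?_
    filter_upwards with z
    rw [Real.norm_of_nonneg (spectralNorm₂_nonneg _)]
    exact hpt z
  refine ⟨hiL, (integral_mono hiL hiR hpt).trans ?_⟩
  have hDk : D ^ (2 * k) = Real.exp k * (K ^ k * (10 ^ 8 * r) ^ k) := by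
    rw [pow_mul, hD2, mul_pow, mul_pow, ← Real.exp_nat_mul, mul_one]
  have h3 : K ^ k / s * evenWalkCount k r ≤ D ^ (2 * k) := by
    calc K ^ k / s * evenWalkCount k r ≤ K ^ k / s * (2 * r * (10 ^ 8 * r) ^ k) := by
          have hKs : 0 ≤ K ^ k / s := by positivity
          exact mul_le_mul_of_nonneg_left (evenWalkCount_le hk0 hkr) hKs
      _ = 2 * r / s * (K ^ k * (10 ^ 8 * r) ^ k) := by ring
      _ ≤ Real.exp k * (K ^ k * (10 ^ 8 * r) ^ k) := by gcongr
      _ = D ^ (2 * k) := hDk.symm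
  rw [integral_const_mul, integral_add (integrable_const _) (hi.div_const _), integral_div]
  simp only [integral_const, probReal_univ, smul_eq_mul, mul_one]
  have h4 : (∫ z, ((matOf z * (matOf z)ᵀ) ^ k).trace ∂(Measure.pi ν)) / D ^ (2 * k) ≤ 1 := by
    rw [div_le_one (by positivity)]
    exact hle.trans h3
  nlinarith

end TraceMoments

/-! ### Symmetrisation -/

section Symmetrisation

lemma integrable_sub_pow_prod (ν : Measure ℝ) [IsProbabilityMeasure ν] {q : ℕ}
    (hint : Integrable (fun x : ℝ => x ^ q) ν) :
    Integrable (fun w : ℝ × ℝ => (w.1 - w.2) ^ q) (ν.prod ν) := by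
  have h1 : Integrable (fun w : ℝ × ℝ => |w.1| ^ q) (ν.prod ν) := by
    have := (hint.comp_fst ν).norm
    simpa [abs_pow] using this
  have h2 : Integrable (fun w : ℝ × ℝ => |w.2| ^ q) (ν.prod ν) := by
    have := (hint.comp_snd ν).norm
    simpa [abs_pow] using this
  refine ((h1.add h2).const_mul (2 ^ (q - 1))).mono'
    (by fun_prop) (Eventually.of_forall fun w => ?_)
  rw [Real.norm_eq_abs, abs_pow]
  exact (pow_le_pow_left₀ (abs_nonneg _) (abs_sub _ _) q).trans
    (add_pow_le (abs_nonneg _) (abs_nonneg _) q)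

lemma integral_sub_pow_prod_of_odd (ν : Measure ℝ) [IsProbabilityMeasure ν] {q : ℕ}
    (hq : Odd q) : ∫ w : ℝ × ℝ, (w.1 - w.2) ^ q ∂(ν.prod ν) = 0 := by
  have h := integral_prod_swap (μ := ν) (ν := ν) (fun w : ℝ × ℝ => (w.1 - w.2) ^ q)
  have h2 : ∀ w : ℝ × ℝ, (w.swap.1 - w.swap.2) ^ q = -(w.1 - w.2) ^ q := fun w => by
    rw [← hq.neg_pow]
    simp
  simp only [h2, integral_neg] at h
  linarith

lemma integral_sub_pow_prod_le (ν : Measure ℝ) [IsProbabilityMeasure ν] {q : ℕ} (hq : 1 ≤ q)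
    (hint : Integrable (fun x : ℝ => x ^ (2 * q)) ν) {s K : ℝ}
    (hle : ∫ x, x ^ (2 * q) ∂ν ≤ s * K ^ q) :
    ∫ w : ℝ × ℝ, (w.1 - w.2) ^ (2 * q) ∂(ν.prod ν) ≤ s * (4 * K) ^ q := by
  have h1 := hint.comp_fst ν
  have h2 := hint.comp_snd ν
  calc ∫ w : ℝ × ℝ, (w.1 - w.2) ^ (2 * q) ∂(ν.prod ν)
      ≤ ∫ w : ℝ × ℝ, 2 ^ (2 * q - 1) * (w.1 ^ (2 * q) + w.2 ^ (2 * q)) ∂(ν.prod ν) := by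
        refine integral_mono (integrable_sub_pow_prod ν hint) ((h1.add h2).const_mul _) fun w => ?_
        have := (even_two_mul q).add_pow_le (a := w.1) (b := -w.2)
        rwa [(even_two_mul q).neg_pow, ← sub_eq_add_neg] at this
    _ = 2 ^ (2 * q - 1) * (2 * ∫ x, x ^ (2 * q) ∂ν) := by
        rw [integral_const_mul, integral_add h1 h2, integral_fun_fst (fun x : ℝ => x ^ (2 * q)),
          integral_fun_snd (fun x : ℝ => x ^ (2 * q))]
        simp [two_mul]
    _ = 4 ^ q * ∫ x, x ^ (2 * q) ∂ν := by
        rw [← mul_assoc, ← pow_succ, show 2 * q - 1 + 1 = 2 * q by omega, pow_mul]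
        norm_num
    _ ≤ 4 ^ q * (s * K ^ q) := by gcongr
    _ = s * (4 * K) ^ q := by rw [mul_pow]; ring

/-- The difference of two independent copies of a family of independent variables. -/
lemma measurePreserving_sub_pi {ι : Type*} [Fintype ι] (ν : ι → Measure ℝ)
    [∀ e, IsProbabilityMeasure (ν e)] :
    MeasurePreserving (fun p : (ι → ℝ) × (ι → ℝ) => p.1 - p.2)
      ((Measure.pi ν).prod (Measure.pi ν))
      (Measure.pi fun e => ((ν e).prod (ν e)).map fun w => w.1 - w.2) := by
  have hm : Measurable fun w : ℝ × ℝ => w.1 - w.2 := measurable_fst.sub measurable_snd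
  have : ∀ e, IsProbabilityMeasure (((ν e).prod (ν e)).map fun w => w.1 - w.2) := fun e =>
    Measure.isProbabilityMeasure_map hm.aemeasurable
  have h1 := (measurePreserving_arrowProdEquivProdArrow ℝ ℝ ι ν ν).symm
  have h2 := measurePreserving_pi (fun e => (ν e).prod (ν e))
    (fun e => ((ν e).prod (ν e)).map fun w => w.1 - w.2) (f := fun _ w => w.1 - w.2)
    fun e => ⟨hm, rfl⟩
  exact h2.comp h1

/-- The linear map sending a family of entries to the operator of the corresponding matrix. -/
noncomputable def operatorOf (m n : ℕ) : (Fin m × Fin n → ℝ) →L[ℝ]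
    (EuclideanSpace ℝ (Fin n) →L[ℝ] EuclideanSpace ℝ (Fin m)) :=
  LinearMap.toContinuousLinearMap
    (LinearMap.toContinuousLinearMap.toLinearMap ∘ₗ
      (Matrix.toEuclideanLin (𝕜 := ℝ) (m := Fin m) (n := Fin n)).toLinearMap ∘ₗ
      { toFun := matOf, map_add' := fun _ _ => rfl, map_smul' := fun _ _ => rfl })

/-- The expected norm of a centred matrix with independent entries, in terms of the even moments of
the uncentred entries. The centring is replaced by the subtraction of an independent copy. -/
lemma integral_spectralNorm₂_centred_le {Ω : Type*} [MeasurableSpace Ω] {μ : Measure Ω}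
    [IsProbabilityMeasure μ] {m n : ℕ} {a : Fin m × Fin n → Ω → ℝ} (ha : ∀ e, Measurable (a e))
    (hind : iIndepFun a μ) (hint : ∀ e q, Integrable (fun ω => a e ω ^ q) μ)
    {j k r : ℕ} (hj : j ≠ 0) (hkj : k = 2 * j)
    {s K D : ℝ} (hs : 0 < s) (hs1 : s ≤ 1) (hK : 0 ≤ K)
    (heven : ∀ e q, 1 ≤ q → q ≤ k → ∫ ω, a e ω ^ (2 * q) ∂μ ≤ s * K ^ q)
    (hm : s * m + k ≤ r) (hn : s * n + k ≤ r) (hD : 0 < D)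
    (hD2 : D ^ 2 = Real.exp 1 * (4 * K * (10 ^ 8 * r))) (hk : 2 * r / s ≤ Real.exp k) :
    ∫ ω, spectralNorm₂ (matOf (fun e => a e ω) - matOf fun e => ∫ ω', a e ω' ∂μ) ∂μ ≤ 2 * D := by
  set ν : Fin m × Fin n → Measure ℝ := fun e => μ.map (a e) with hν
  have hνp : ∀ e, IsProbabilityMeasure (ν e) := fun e =>
    Measure.isProbabilityMeasure_map (ha e).aemeasurable
  have hlaw : μ.map (fun ω e => a e ω) = Measure.pi ν :=
    hind.map_fun_eq_pi_map fun e => (ha e).aemeasurable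
  have hameas : Measurable fun ω e => a e ω := measurable_pi_lambda _ ha
  have hνint : ∀ e q, Integrable (fun x : ℝ => x ^ q) (ν e) := fun e q =>
    (integrable_map_measure (by fun_prop) (ha e).aemeasurable).2 (hint e q)
  have hνmom : ∀ e q, ∫ x, x ^ q ∂(ν e) = ∫ ω, a e ω ^ q ∂μ := fun e q =>
    integral_map (ha e).aemeasurable (by fun_prop)
  set c : Fin m × Fin n → ℝ := fun e => ∫ ω', a e ω' ∂μ with hc
  set T := operatorOf m n with hT
  have hmeas : Measurable fun w : ℝ × ℝ => w.1 - w.2 := measurable_fst.sub measurable_snd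
  set lam : Fin m × Fin n → Measure ℝ := fun e => ((ν e).prod (ν e)).map fun w => w.1 - w.2
    with hlam
  have hlamp : ∀ e, IsProbabilityMeasure (lam e) := fun e =>
    Measure.isProbabilityMeasure_map hmeas.aemeasurable
  have hlmom : ∀ e q, ∫ x, x ^ q ∂(lam e) = ∫ w : ℝ × ℝ, (w.1 - w.2) ^ q ∂((ν e).prod (ν e)) :=
    fun e q => integral_map hmeas.aemeasurable (by fun_prop)
  obtain ⟨hi, hle⟩ := integral_spectralNorm₂_le (m := m) (n := n) lam (j := j) (k := k) (r := r)
    (s := s) (K := 4 * K) (D := D)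
    (fun e q => (integrable_map_measure (by fun_prop) hmeas.aemeasurable).2
      (integrable_sub_pow_prod (ν e) (hνint e q)))
    (fun e q hq => by rw [hlmom, integral_sub_pow_prod_of_odd _ hq]) hj hkj hs hs1 (by positivity)
    (fun e q hq1 hqk => by
      rw [hlmom]
      exact integral_sub_pow_prod_le (ν e) hq1 (hνint e _) (by rw [hνmom]; exact heven e q hq1 hqk))
    hm hn hD hD2 hk
  have hmp := measurePreserving_sub_pi ν
  have hTc : Continuous fun z : Fin m × Fin n → ℝ => ‖T z‖ := T.continuous.norm
  have hi' : Integrable (fun p : (Fin m × Fin n → ℝ) × (Fin m × Fin n → ℝ) => ‖T (p.1 - p.2)‖)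
      ((Measure.pi ν).prod (Measure.pi ν)) := hmp.integrable_comp_of_integrable hi
  have hle' : ∫ p : (Fin m × Fin n → ℝ) × (Fin m × Fin n → ℝ), ‖T (p.1 - p.2)‖
      ∂((Measure.pi ν).prod (Measure.pi ν)) ≤ 2 * D := by
    have h : ∫ z, ‖T z‖ ∂(Measure.pi lam) ≤ 2 * D := hle
    rwa [← hmp.map_eq, integral_map hmp.measurable.aemeasurable hTc.aestronglyMeasurable] at h
  have hevi : ∀ e, Integrable (fun z : Fin m × Fin n → ℝ => z e) (Measure.pi ν) := fun e =>
    integrable_comp_eval (μ := ν) (i := e) (f := fun x : ℝ => x) (by simpa using hνint e 1)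
  have heval : ∀ e, ∫ z, z e ∂(Measure.pi ν) = c e := fun e => by
    rw [integral_comp_eval (μ := ν) (i := e) (f := fun x : ℝ => x) (by fun_prop)]
    simpa using hνmom e 1
  have hsubi : ∀ (z : Fin m × Fin n → ℝ) (e), Integrable (fun z' => (z - z') e) (Measure.pi ν) :=
    fun z e => (integrable_const (z e)).sub (hevi e)
  have hcent : ∀ z : Fin m × Fin n → ℝ, ∫ z', (z - z') ∂(Measure.pi ν) = z - c := by
    intro z
    ext e
    rw [eval_integral (hsubi z)]
    simp only [Pi.sub_apply]
    rw [integral_sub (integrable_const _) (hevi e), heval e]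
    simp
  have hjensen : ∀ z : Fin m × Fin n → ℝ, ‖T (z - c)‖ ≤ ∫ z', ‖T (z - z')‖ ∂(Measure.pi ν) := by
    intro z
    rw [← hcent z, ← ContinuousLinearMap.integral_comp_comm T (Integrable.of_eval (hsubi z))]
    exact norm_integral_le_integral_norm _
  calc ∫ ω, spectralNorm₂ (matOf (fun e => a e ω) - matOf c) ∂μ
      = ∫ z, ‖T (z - c)‖ ∂(Measure.pi ν) := by
        rw [← hlaw, integral_map hameas.aemeasurable]
        · rfl
        · exact (hTc.comp (continuous_id.sub continuous_const)).aestronglyMeasurable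
    _ ≤ ∫ z, ∫ z', ‖T (z - z')‖ ∂(Measure.pi ν) ∂(Measure.pi ν) :=
        integral_mono_of_nonneg (Eventually.of_forall fun z => norm_nonneg _) hi'.integral_prod_left
          (Eventually.of_forall hjensen)
    _ = ∫ p : (Fin m × Fin n → ℝ) × (Fin m × Fin n → ℝ), ‖T (p.1 - p.2)‖
          ∂((Measure.pi ν).prod (Measure.pi ν)) := (integral_prod _ hi').symm
    _ ≤ 2 * D := hle'

end Symmetrisation

/-! ### Nuclear norm -/

section NuclearNorm

lemma sum_norm_sq_toEuclideanLin_eq {m n : ℕ} {ι : Type*} [Fintype ι]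
    (B : Matrix (Fin m) (Fin n) ℝ) (v : OrthonormalBasis ι ℝ (EuclideanSpace ℝ (Fin n))) :
    ∑ i, ‖Matrix.toEuclideanLin B (v i)‖ ^ 2 = frobeniusSq B := by
  simp_rw [EuclideanSpace.real_norm_sq_eq]
  rw [Finset.sum_comm, frobeniusSq]
  refine Finset.sum_congr rfl fun j _ => ?_
  have h1 : ∀ i, (Matrix.toEuclideanLin B (v i)) j = inner ℝ (v i) (WithLp.toLp 2 (B j)) :=
    fun i => by
      simp [Matrix.toLpLin_apply, Matrix.mulVec, dotProduct, PiLp.inner_apply]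
  have h2 := v.sum_sq_norm_inner_right (WithLp.toLp 2 (B j))
  rw [EuclideanSpace.real_norm_sq_eq] at h2
  simp only [Real.norm_eq_abs, sq_abs] at h2
  simp only [h1]
  exact h2

lemma finrank_range_toEuclideanLin {m n : ℕ} (B : Matrix (Fin m) (Fin n) ℝ) :
    Module.finrank ℝ (LinearMap.range (Matrix.toEuclideanLin B)) = B.rank := by
  rw [Matrix.toEuclideanLin_eq_toLin_orthonormal, ← Matrix.rank_eq_finrank_range_toLin]

/-- The pairing of a matrix with two orthonormal families, bounded through the rank. -/
lemma sum_inner_toEuclideanLin_le_rank {m n : ℕ} {ι κ : Type*} [Fintype ι] [Fintype κ]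
    (B : Matrix (Fin m) (Fin n) ℝ) (v : OrthonormalBasis ι ℝ (EuclideanSpace ℝ (Fin n)))
    (g : κ → ι) (hg : Function.Injective g) {u : κ → EuclideanSpace ℝ (Fin m)}
    (hu : Orthonormal ℝ u) :
    ∑ i, inner ℝ (u i) (Matrix.toEuclideanLin B (v (g i))) ≤
      √(B.rank) * √(frobeniusSq B) := by
  classical
  set W := LinearMap.range (Matrix.toEuclideanLin B) with hW
  set w := stdOrthonormalBasis ℝ W with hw
  have hwo : Orthonormal ℝ fun j => (w j : EuclideanSpace ℝ (Fin m)) :=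
    w.orthonormal.comp_linearIsometry W.subtypeₗᵢ
  have hmem : ∀ x, Matrix.toEuclideanLin B x ∈ W := fun x => LinearMap.mem_range_self _ x
  have hexp : ∀ i, inner ℝ (u i) (Matrix.toEuclideanLin B (v (g i))) =
      ∑ j, inner ℝ (u i) (w j : EuclideanSpace ℝ (Fin m)) *
        inner ℝ (w j) (⟨_, hmem (v (g i))⟩ : W) := by
    intro i
    have h1 := w.sum_repr' (⟨_, hmem (v (g i))⟩ : W)
    have h2 := congrArg (Subtype.val) h1
    simp only [Submodule.coe_sum, Submodule.coe_smul] at h2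
    conv_lhs => rw [← h2, inner_sum]
    refine Finset.sum_congr rfl fun j _ => ?_
    rw [inner_smul_right, mul_comm]
  have hA : ∑ ij : κ × _, inner ℝ (u ij.1) (w ij.2 : EuclideanSpace ℝ (Fin m)) ^ 2 ≤
      (B.rank : ℝ) := by
    rw [Fintype.sum_prod_type_right]
    calc _ ≤ ∑ j, ‖(w j : EuclideanSpace ℝ (Fin m))‖ ^ 2 := by
          refine Finset.sum_le_sum fun j _ => ?_
          have := hu.sum_inner_products_le (w j : EuclideanSpace ℝ (Fin m)) (s := Finset.univ)
          simpa only [Real.norm_eq_abs, sq_abs] using this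
      _ = (B.rank : ℝ) := by
          simp only [hwo.1, one_pow, Finset.sum_const, Finset.card_univ, Fintype.card_fin,
            nsmul_eq_mul, mul_one]
          rw [hW, finrank_range_toEuclideanLin]
  have hB : ∑ ij : κ × _, inner ℝ (w ij.2) (⟨_, hmem (v (g ij.1))⟩ : W) ^ 2 ≤ frobeniusSq B := by
    rw [Fintype.sum_prod_type, ← sum_norm_sq_toEuclideanLin_eq B v]
    calc _ = ∑ i, ‖Matrix.toEuclideanLin B (v (g i))‖ ^ 2 := by
          refine Finset.sum_congr rfl fun i _ => ?_
          have := w.sum_sq_norm_inner_right (⟨_, hmem (v (g i))⟩ : W)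
          simp only [Real.norm_eq_abs, sq_abs] at this
          exact this
      _ = ∑ l ∈ Finset.univ.map ⟨g, hg⟩, ‖Matrix.toEuclideanLin B (v l)‖ ^ 2 := by
          rw [Finset.sum_map]
          rfl
      _ ≤ _ := Finset.sum_le_sum_of_subset_of_nonneg (Finset.subset_univ _)
          fun _ _ _ => sq_nonneg _
  simp only [hexp]
  rw [← Fintype.sum_prod_type' (f := fun i j => inner ℝ (u i) (w j : EuclideanSpace ℝ (Fin m)) *
        inner ℝ (w j) (⟨_, hmem (v (g i))⟩ : W))]
  refine (Real.sum_mul_le_sqrt_mul_sqrt _ _ _).trans ?_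
  exact mul_le_mul (Real.sqrt_le_sqrt hA) (Real.sqrt_le_sqrt hB) (Real.sqrt_nonneg _)
    (Real.sqrt_nonneg _)

/-- The pairing of a matrix with two orthonormal families, bounded through their cardinality. -/
lemma sum_inner_toEuclideanLin_le_card {m n : ℕ} {ι κ : Type*} [Fintype ι] [Fintype κ]
    (B : Matrix (Fin m) (Fin n) ℝ) (v : OrthonormalBasis ι ℝ (EuclideanSpace ℝ (Fin n)))
    (g : κ → ι) (hg : Function.Injective g) {u : κ → EuclideanSpace ℝ (Fin m)}
    (hu : Orthonormal ℝ u) :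
    ∑ i, inner ℝ (u i) (Matrix.toEuclideanLin B (v (g i))) ≤
      √(Fintype.card κ) * √(frobeniusSq B) := by
  calc ∑ i, inner ℝ (u i) (Matrix.toEuclideanLin B (v (g i)))
      ≤ ∑ i, 1 * ‖Matrix.toEuclideanLin B (v (g i))‖ := by
        refine Finset.sum_le_sum fun i _ => ?_
        rw [← hu.1 i]
        exact real_inner_le_norm _ _
    _ ≤ √(∑ _i : κ, 1 ^ 2) * √(∑ i, ‖Matrix.toEuclideanLin B (v (g i))‖ ^ 2) :=
        Real.sum_mul_le_sqrt_mul_sqrt _ _ _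
    _ ≤ √(Fintype.card κ) * √(frobeniusSq B) := by
        refine mul_le_mul (Real.sqrt_le_sqrt (by simp)) (Real.sqrt_le_sqrt ?_)
          (Real.sqrt_nonneg _) (Real.sqrt_nonneg _)
        rw [← sum_norm_sq_toEuclideanLin_eq B v]
        calc _ = ∑ l ∈ Finset.univ.map ⟨g, hg⟩, ‖Matrix.toEuclideanLin B (v l)‖ ^ 2 := by
              rw [Finset.sum_map]
              rfl
          _ ≤ _ := Finset.sum_le_sum_of_subset_of_nonneg (Finset.subset_univ _)
              fun _ _ _ => sq_nonneg _

/-- Splitting a matrix into a low rank part and a remainder. The proof pairs the matrix with its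
left and right singular vectors. -/
lemma nuclearNorm_le {m n : ℕ} (M A : Matrix (Fin m) (Fin n) ℝ) :
    nuclearNorm M ≤ √(A.rank) * √(frobeniusSq A) + √m * √(frobeniusSq (M - A)) := by
  classical
  set T := Matrix.toEuclideanLin M with hT
  have hn : Module.finrank ℝ (EuclideanSpace ℝ (Fin n)) = n := finrank_euclideanSpace_fin
  set v := T.isSymmetric_adjoint_comp_self.eigenvectorBasis hn with hv
  set σ : Fin n → ℝ := fun i => T.singularValues i with hσ
  have heig : ∀ i, (LinearMap.adjoint T) (T (v i)) = (σ i ^ 2) • v i := by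
    intro i
    have := T.isSymmetric_adjoint_comp_self.apply_eigenvectorBasis hn i
    rw [← T.sq_singularValues_fin hn i] at this
    exact this
  have hinner : ∀ i j, inner ℝ (T (v i)) (T (v j)) = if i = j then σ j ^ 2 else 0 := by
    intro i j
    rw [← LinearMap.adjoint_inner_right, heig, inner_smul_right,
      orthonormal_iff_ite.1 v.orthonormal i j]
    split_ifs <;> simp
  let κ := {i : Fin n // (i : ℕ) < min m n ∧ σ i ≠ 0}
  let g : κ → Fin n := Subtype.val
  have hg : Function.Injective g := Subtype.val_injective
  let u : κ → EuclideanSpace ℝ (Fin m) := fun i => (σ (g i))⁻¹ • T (v (g i))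
  have hu : Orthonormal ℝ u := by
    rw [orthonormal_iff_ite]
    intro i j
    have hj : σ (g j) ≠ 0 := j.2.2
    simp only [u, inner_smul_left, inner_smul_right, hinner, hg.eq_iff, conj_trivial]
    split_ifs with h
    · subst h
      field_simp
    · simp
  have hval : ∀ i : κ, inner ℝ (u i) (T (v (g i))) = σ (g i) := by
    intro i
    have hi : σ (g i) ≠ 0 := i.2.2
    simp only [u, inner_smul_left, hinner, if_true, conj_trivial]
    field_simp
  have hsum : nuclearNorm M = ∑ i : κ, σ (g i) := by
    have h1 : ∑ i : κ, σ (g i) =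
        ∑ i ∈ Finset.univ.filter (fun i : Fin n => (i : ℕ) < min m n ∧ σ i ≠ 0), σ i :=
      (Finset.sum_subtype _ (by simp) _).symm
    have h2 : nuclearNorm M =
        ∑ i ∈ Finset.univ.filter (fun i : Fin n => (i : ℕ) < min m n), σ i := by
      rw [nuclearNorm]
      symm
      refine Finset.sum_bij (fun i _ => (i : ℕ)) ?_ ?_ ?_ ?_
      · intro i hi
        simpa using hi
      · intro i _ j _ h
        exact Fin.ext h
      · intro b hb
        have hb' := Finset.mem_range.1 hb
        exact ⟨⟨b, lt_of_lt_of_le hb' (min_le_right _ _)⟩,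
          Finset.mem_filter.2 ⟨Finset.mem_univ _, hb'⟩, rfl⟩
      · intro i _
        rfl
    rw [h1, h2, ← Finset.filter_filter, Finset.sum_filter_ne_zero]
  have hcard : Fintype.card κ ≤ m := by
    have := Fintype.card_le_of_injective (fun i : κ => (⟨(g i : ℕ), lt_of_lt_of_le i.2.1
      (min_le_left _ _)⟩ : Fin m)) fun i j h => hg (Fin.ext (Fin.mk.inj h))
    simpa using this
  have hsplit : ∀ i : κ, σ (g i) = inner ℝ (u i) (Matrix.toEuclideanLin A (v (g i))) +
      inner ℝ (u i) (Matrix.toEuclideanLin (M - A) (v (g i))) := by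
    intro i
    rw [← inner_add_right, ← LinearMap.add_apply, ← map_add, add_sub_cancel, ← hval i]
  rw [hsum]
  simp only [hsplit]
  rw [Finset.sum_add_distrib]
  refine add_le_add (sum_inner_toEuclideanLin_le_rank A v g hg hu)
    ((sum_inner_toEuclideanLin_le_card (M - A) v g hg hu).trans ?_)
  gcongr

end NuclearNorm

/-! ### Sub-gaussian moments -/

section SubGaussian

variable {Ω : Type*} [MeasurableSpace Ω] {μ : Measure Ω}

/-- The infimum in the definition of the sub-gaussian norm need not be attained, so the scale
`σ + 1` is used in place of `σ`. -/
lemma lintegral_exp_le_two {X : Ω → ℝ} {σ : ℝ≥0} (h : psi2Norm μ X ≤ σ) :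
    ∫⁻ ω, ENNReal.ofReal (Real.exp (X ω ^ 2 / ((σ : ℝ) + 1) ^ 2)) ∂μ ≤ 2 := by
  have h1 : psi2Norm μ X < ((σ + 1 : ℝ≥0) : ℝ≥0∞) :=
    h.trans_lt (by exact_mod_cast lt_add_one σ)
  obtain ⟨⟨t, ht0, ht⟩, hlt⟩ := iInf_lt_iff.1 h1
  have hlt : t < σ + 1 := by exact_mod_cast hlt
  have ht1 : (t : ℝ) ≤ (σ : ℝ) + 1 := by exact_mod_cast hlt.le
  have ht0' : (0 : ℝ) < t := by exact_mod_cast ht0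
  refine (lintegral_mono fun ω => ?_).trans ht
  apply ENNReal.ofReal_le_ofReal
  gcongr

lemma integrable_exp_sq {X : Ω → ℝ} (hX : Measurable X) {σ : ℝ≥0} (h : psi2Norm μ X ≤ σ) :
    Integrable (fun ω => Real.exp (X ω ^ 2 / ((σ : ℝ) + 1) ^ 2)) μ ∧
      ∫ ω, Real.exp (X ω ^ 2 / ((σ : ℝ) + 1) ^ 2) ∂μ ≤ 2 := by
  have hm : AEStronglyMeasurable (fun ω => Real.exp (X ω ^ 2 / ((σ : ℝ) + 1) ^ 2)) μ := by
    fun_prop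
  have hle := lintegral_exp_le_two h
  have hi : Integrable (fun ω => Real.exp (X ω ^ 2 / ((σ : ℝ) + 1) ^ 2)) μ := by
    refine ⟨hm, ?_⟩
    rw [hasFiniteIntegral_iff_ofReal (Eventually.of_forall fun ω => (Real.exp_pos _).le)]
    exact hle.trans_lt (by simp)
  refine ⟨hi, ?_⟩
  rw [← ofReal_integral_eq_lintegral_ofReal hi
    (Eventually.of_forall fun ω => (Real.exp_pos _).le)] at hle
  have := ENNReal.toReal_mono (by simp) hle
  rwa [ENNReal.toReal_ofReal (integral_nonneg fun ω => (Real.exp_pos _).le)] at this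

lemma pow_two_mul_le_exp {t : ℝ} (ht : 0 < t) (x : ℝ) (q : ℕ) :
    x ^ (2 * q) ≤ q.factorial * (t ^ 2) ^ q * Real.exp (x ^ 2 / t ^ 2) := by
  have h := Real.pow_div_factorial_le_exp (x ^ 2 / t ^ 2) (by positivity) q
  rw [div_le_iff₀ (by positivity), div_pow, div_le_iff₀ (by positivity)] at h
  rw [pow_mul]
  linarith

variable [IsProbabilityMeasure μ]

lemma integrable_pow_of_psi2Norm_le {X : Ω → ℝ} (hX : Measurable X) {σ : ℝ≥0}
    (h : psi2Norm μ X ≤ σ) (q : ℕ) : Integrable (fun ω => X ω ^ q) μ := by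
  have ht : (0 : ℝ) < (σ : ℝ) + 1 := by positivity
  obtain ⟨hi, -⟩ := integrable_exp_sq hX h
  refine ((hi.const_mul (q.factorial * (((σ : ℝ) + 1) ^ 2) ^ q)).add (integrable_const 1)).mono'
    (by fun_prop) (Eventually.of_forall fun ω => ?_)
  have h1 := pow_two_mul_le_exp ht (X ω) q
  have h2 : |X ω| ^ q ≤ X ω ^ (2 * q) + 1 := by
    have h3 : X ω ^ (2 * q) = (|X ω| ^ q) ^ 2 := by
      rw [← pow_mul, mul_comm q 2, (even_two_mul q).pow_abs]
    rw [h3]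
    nlinarith [sq_nonneg (|X ω| ^ q - 1), pow_nonneg (abs_nonneg (X ω)) q]
  rw [Real.norm_eq_abs, abs_pow]
  simp only [Pi.add_apply]
  linarith

lemma integral_pow_le_of_psi2Norm_le {X : Ω → ℝ} (hX : Measurable X) {σ : ℝ≥0}
    (h : psi2Norm μ X ≤ σ) (q : ℕ) :
    ∫ ω, X ω ^ (2 * q) ∂μ ≤ 2 * q.factorial * (((σ : ℝ) + 1) ^ 2) ^ q := by
  have ht : (0 : ℝ) < (σ : ℝ) + 1 := by positivity
  obtain ⟨hi, hle⟩ := integrable_exp_sq hX h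
  calc ∫ ω, X ω ^ (2 * q) ∂μ
      ≤ ∫ ω, q.factorial * (((σ : ℝ) + 1) ^ 2) ^ q *
          Real.exp (X ω ^ 2 / ((σ : ℝ) + 1) ^ 2) ∂μ :=
        integral_mono (integrable_pow_of_psi2Norm_le hX h _) (hi.const_mul _)
          fun ω => pow_two_mul_le_exp ht (X ω) q
    _ ≤ q.factorial * (((σ : ℝ) + 1) ^ 2) ^ q * 2 := by
        rw [integral_const_mul]
        gcongr
    _ = _ := by ring

lemma factorial_le_pow_pred {q k : ℕ} (hq : 1 ≤ q) (hqk : q ≤ k) :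
    q.factorial ≤ k ^ (q - 1) := by
  induction q, hq using Nat.le_induction with
  | base => simp
  | succ q hq ih =>
    obtain ⟨l, rfl⟩ := Nat.exists_eq_add_of_le' hq
    rw [Nat.factorial_succ, Nat.add_sub_cancel, pow_succ, mul_comm]
    exact Nat.mul_le_mul (ih (by omega)) hqk

end SubGaussian

/-! ### The partially observed model -/

section Model

variable {Ω : Type*} {m n : ℕ} {X : Matrix (Fin m) (Fin n) (Ω → ℝ)}
  {O : Matrix (Fin m) (Fin n) (Ω → Bool)}

/-- The entries of the data matrix with missing values replaced by `0`, as random variables. -/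
def maskedEntry (X : Matrix (Fin m) (Fin n) (Ω → ℝ)) (O : Matrix (Fin m) (Fin n) (Ω → Bool))
    (e : Fin m × Fin n) (ω : Ω) : ℝ :=
  if O e.1 e.2 ω then X e.1 e.2 ω else 0

/-- The observation indicators, as real random variables. -/
def obsIndicator (O : Matrix (Fin m) (Fin n) (Ω → Bool)) (e : Fin m × Fin n) (ω : Ω) : ℝ :=
  if O e.1 e.2 ω then 1 else 0

lemma zeroFill_dataMatrix (ω : Ω) :
    zeroFill (dataMatrix X O ω) = matOf fun e => maskedEntry X O e ω := by
  ext i j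
  by_cases hO : O i j ω = true <;>
    simp [zeroFill, dataMatrix, observe, matOf, maskedEntry, hO]

lemma observedFraction_dataMatrix (ω : Ω) :
    observedFraction (dataMatrix X O ω) =
      max ((∑ e, obsIndicator O e ω) / ((m : ℝ) * n)) (1 / ((m : ℝ) * n)) := by
  rw [observedFraction, Fintype.sum_prod_type]
  congr 2
  refine Finset.sum_congr rfl fun i _ => Finset.sum_congr rfl fun j _ => ?_
  by_cases hO : O i j ω = true <;> simp [dataMatrix, observe, obsIndicator, hO]

/-- The noise matrix: the centred data matrix with missing entries replaced by `0`. -/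
def noise (X : Matrix (Fin m) (Fin n) (Ω → ℝ)) (O : Matrix (Fin m) (Fin n) (Ω → Bool))
    (M : Matrix (Fin m) (Fin n) ℝ) (p : ℝ) (ω : Ω) : Matrix (Fin m) (Fin n) ℝ :=
  zeroFill (dataMatrix X O ω) - p • M

variable [MeasurableSpace Ω] {μ : Measure Ω} {M : Matrix (Fin m) (Fin n) ℝ} {p : ℝ} {σ : ℝ≥0}
  {r δ : ℝ}

lemma IsImputable.measurable_obsIndicator (h : IsImputable μ X O M p σ r δ) (e : Fin m × Fin n) :
    Measurable (obsIndicator O e) :=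
  (measurable_of_countable fun b : Bool => if b then (1 : ℝ) else 0).comp (h.measurable_O e.1 e.2)

lemma IsImputable.measurable_maskedEntry (h : IsImputable μ X O M p σ r δ) (e : Fin m × Fin n) :
    Measurable (maskedEntry X O e) := by
  have : maskedEntry X O e = fun ω => obsIndicator O e ω * X e.1 e.2 ω := by
    ext ω
    simp [maskedEntry, obsIndicator]
  rw [this]
  exact (h.measurable_obsIndicator e).mul (h.measurable_X e.1 e.2)

lemma IsImputable.iIndepFun_obs (h : IsImputable μ X O M p σ r δ) :
    iIndepFun (fun e : Fin m × Fin n => O e.1 e.2) μ :=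
  h.indep.comp (fun _ w => w.2) fun _ => measurable_snd

lemma IsImputable.iIndepFun_obsIndicator (h : IsImputable μ X O M p σ r δ) :
    iIndepFun (obsIndicator O) μ :=
  h.iIndepFun_obs.comp (fun _ b => if b then (1 : ℝ) else 0) fun _ => measurable_of_countable _

lemma IsImputable.iIndepFun_maskedEntry (h : IsImputable μ X O M p σ r δ) :
    iIndepFun (maskedEntry X O) μ := by
  refine h.indep.comp (fun _ w => if w.2 then w.1 else 0) fun _ => ?_
  exact Measurable.ite (measurable_snd (measurableSet_singleton true)) measurable_fst
    measurable_const

lemma IsImputable.integral_obsIndicator (h : IsImputable μ X O M p σ r δ) (e : Fin m × Fin n) :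
    ∫ ω, obsIndicator O e ω ∂μ = p := by
  have hs : MeasurableSet {ω | O e.1 e.2 ω = true} :=
    h.measurable_O e.1 e.2 (measurableSet_singleton true)
  have : obsIndicator O e = Set.indicator {ω | O e.1 e.2 ω = true} 1 := by
    ext ω
    simp [obsIndicator, Set.indicator_apply]
  rw [this, integral_indicator_one hs, measureReal_def, h.prob_obs,
    ENNReal.toReal_ofReal h.p_pos.le]

/-- Masking multiplies every moment by the observation probability. -/
lemma IsImputable.integral_maskedEntry_pow (h : IsImputable μ X O M p σ r δ) (e : Fin m × Fin n)
    {q : ℕ} (hq : q ≠ 0) :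
    ∫ ω, maskedEntry X O e ω ^ q ∂μ = p * ∫ ω, X e.1 e.2 ω ^ q ∂μ := by
  have h1 : ∀ ω, maskedEntry X O e ω ^ q =
      X e.1 e.2 ω ^ q * (fun b : Bool => if b then (1 : ℝ) else 0) (O e.1 e.2 ω) := by
    intro ω
    simp only [maskedEntry]
    split_ifs <;> simp [hq]
  simp_rw [h1]
  rw [(h.indep_obs e.1 e.2).integral_fun_comp_mul_comp (f := fun x : ℝ => x ^ q)
    (g := fun b : Bool => if b then (1 : ℝ) else 0) (h.measurable_X _ _).aemeasurable
    (h.measurable_O _ _).aemeasurable (by fun_prop)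
    (measurable_of_countable _).aestronglyMeasurable, mul_comm]
  congr 1
  exact h.integral_obsIndicator e

lemma IsImputable.integral_maskedEntry (h : IsImputable μ X O M p σ r δ) (e : Fin m × Fin n) :
    ∫ ω, maskedEntry X O e ω ∂μ = p * M e.1 e.2 := by
  have := h.integral_maskedEntry_pow e one_ne_zero
  simpa [h.mean] using this

lemma IsImputable.noise_eq (h : IsImputable μ X O M p σ r δ) (ω : Ω) :
    noise X O M p ω =
      matOf (fun e => maskedEntry X O e ω) - matOf fun e => ∫ ω', maskedEntry X O e ω' ∂μ := by
  rw [noise, zeroFill_dataMatrix]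
  congr 1
  ext i j
  simp [matOf, h.integral_maskedEntry]

lemma IsImputable.noise_apply (h : IsImputable μ X O M p σ r δ) (ω : Ω) (i : Fin m) (j : Fin n) :
    noise X O M p ω i j =
      maskedEntry X O (i, j) ω - ∫ ω', maskedEntry X O (i, j) ω' ∂μ := by
  rw [h.noise_eq]
  rfl

lemma IsImputable.measurable_spectralNorm₂_noise (h : IsImputable μ X O M p σ r δ) :
    Measurable fun ω => spectralNorm₂ (noise X O M p ω) := by
  have h1 : (fun ω => spectralNorm₂ (noise X O M p ω)) = fun ω =>
      (fun z : Fin m × Fin n → ℝ => spectralNorm₂ (matOf z))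
        (fun e => maskedEntry X O e ω - ∫ ω', maskedEntry X O e ω' ∂μ) := by
    ext ω
    rw [h.noise_eq]
    rfl
  rw [h1]
  exact (continuous_spectralNorm₂.comp continuous_matOf).measurable.comp
    (measurable_pi_lambda _ fun e => (h.measurable_maskedEntry e).sub_const _)

variable [IsProbabilityMeasure μ]

lemma IsImputable.integrable_maskedEntry_pow (h : IsImputable μ X O M p σ r δ)
    (e : Fin m × Fin n) (q : ℕ) : Integrable (fun ω => maskedEntry X O e ω ^ q) μ := by
  rcases eq_or_ne q 0 with rfl | hq
  · simp
  refine (integrable_pow_of_psi2Norm_le (h.measurable_X e.1 e.2) (h.subgaussian e.1 e.2) q).mono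
    ((h.measurable_maskedEntry e).pow_const q).aestronglyMeasurable
    (Eventually.of_forall fun ω => ?_)
  simp only [maskedEntry]
  split_ifs <;> simp [hq]

/-- The even moments of the masked entries, in the form of those of a sparse matrix. The factor
`1 / k` gained from `q! ≤ k ^ (q - 1)` keeps the second moment of order `p`. -/
lemma IsImputable.integral_maskedEntry_pow_le (h : IsImputable μ X O M p σ r δ)
    (e : Fin m × Fin n) {q k : ℕ} (hq : 1 ≤ q) (hqk : q ≤ k) :
    ∫ ω, maskedEntry X O e ω ^ (2 * q) ∂μ ≤ 2 * p / k * (((σ : ℝ) + 1) ^ 2 * k) ^ q := by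
  have hp := h.p_pos
  have hk : (0 : ℝ) < k := by exact_mod_cast hq.trans hqk
  have hf : (q.factorial : ℝ) ≤ (k : ℝ) ^ (q - 1) := by
    exact_mod_cast factorial_le_pow_pred hq hqk
  rw [h.integral_maskedEntry_pow e (by omega)]
  calc p * ∫ ω, X e.1 e.2 ω ^ (2 * q) ∂μ
      ≤ p * (2 * q.factorial * (((σ : ℝ) + 1) ^ 2) ^ q) := by
        gcongr
        exact integral_pow_le_of_psi2Norm_le (h.measurable_X _ _) (h.subgaussian _ _) q
    _ ≤ p * (2 * (k : ℝ) ^ (q - 1) * (((σ : ℝ) + 1) ^ 2) ^ q) := by gcongr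
    _ = 2 * p / k * (((σ : ℝ) + 1) ^ 2 * k) ^ q := by
        have : (k : ℝ) ^ q = k ^ (q - 1) * k := by
          rw [← pow_succ, Nat.sub_add_cancel hq]
        rw [mul_pow, this]
        field_simp

lemma IsImputable.integral_X_sq_le (h : IsImputable μ X O M p σ r δ) (i : Fin m) (j : Fin n) :
    ∫ ω, X i j ω ^ 2 ∂μ ≤ 2 * ((σ : ℝ) + 1) ^ 2 := by
  have := integral_pow_le_of_psi2Norm_le (h.measurable_X i j) (h.subgaussian i j) 1
  simpa using this

lemma IsImputable.mean_sq_le (h : IsImputable μ X O M p σ r δ) (i : Fin m) (j : Fin n) :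
    M i j ^ 2 ≤ 2 * ((σ : ℝ) + 1) ^ 2 := by
  have h2 : MemLp (X i j) 2 μ :=
    (memLp_two_iff_integrable_sq (h.measurable_X i j).aestronglyMeasurable).2
      (integrable_pow_of_psi2Norm_le (h.measurable_X i j) (h.subgaussian i j) 2)
  have hv := variance_nonneg (X i j) μ
  rw [variance_eq_sub h2] at hv
  have h3 := h.integral_X_sq_le i j
  have h4 := h.mean i j
  simp only [Pi.pow_apply] at hv
  rw [h4] at hv
  linarith

lemma IsImputable.frobeniusSq_mean_le (h : IsImputable μ X O M p σ r δ) :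
    frobeniusSq M ≤ 2 * ((σ : ℝ) + 1) ^ 2 * (m * n) := by
  calc frobeniusSq M ≤ ∑ _i : Fin m, ∑ _j : Fin n, 2 * ((σ : ℝ) + 1) ^ 2 :=
        Finset.sum_le_sum fun i _ => Finset.sum_le_sum fun j _ => h.mean_sq_le i j
    _ = _ := by
        simp only [Finset.sum_const, Finset.card_univ, Fintype.card_fin, nsmul_eq_mul]
        ring

lemma IsImputable.integrable_noise_sq (h : IsImputable μ X O M p σ r δ) (i : Fin m) (j : Fin n) :
    Integrable (fun ω => noise X O M p ω i j ^ 2) μ := by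
  simp_rw [h.noise_apply]
  have h2 : MemLp (maskedEntry X O (i, j)) 2 μ :=
    (memLp_two_iff_integrable_sq (h.measurable_maskedEntry _).aestronglyMeasurable).2
      (h.integrable_maskedEntry_pow _ 2)
  exact (h2.sub (memLp_const _)).integrable_sq

lemma IsImputable.integrable_frobeniusSq_noise (h : IsImputable μ X O M p σ r δ) :
    Integrable (fun ω => frobeniusSq (noise X O M p ω)) μ :=
  integrable_finsetSum _ fun i _ => integrable_finsetSum _ fun j _ => h.integrable_noise_sq i j

lemma IsImputable.integral_frobeniusSq_noise_le (h : IsImputable μ X O M p σ r δ) :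
    ∫ ω, frobeniusSq (noise X O M p ω) ∂μ ≤ 2 * ((σ : ℝ) + 1) ^ 2 * (m * n) := by
  have hent : ∀ i j, ∫ ω, noise X O M p ω i j ^ 2 ∂μ ≤ 2 * ((σ : ℝ) + 1) ^ 2 := by
    intro i j
    simp_rw [h.noise_apply]
    have hm := h.measurable_maskedEntry (i, j)
    rw [← variance_eq_integral hm.aemeasurable]
    refine (variance_le_expectation_sq hm.aestronglyMeasurable).trans ?_
    have h1 := h.integral_maskedEntry_pow (i, j) two_ne_zero
    have h2 := h.integral_X_sq_le i j
    simp only [Pi.pow_apply]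
    rw [h1]
    calc p * ∫ ω, X i j ω ^ 2 ∂μ ≤ 1 * ∫ ω, X i j ω ^ 2 ∂μ :=
          mul_le_mul_of_nonneg_right h.p_le_one (integral_nonneg fun ω => sq_nonneg _)
      _ ≤ _ := by rwa [one_mul]
  simp only [frobeniusSq]
  rw [integral_finsetSum _ fun i _ => integrable_finsetSum _ fun j _ => h.integrable_noise_sq i j]
  simp_rw [integral_finsetSum _ fun j _ => h.integrable_noise_sq _ j]
  calc _ ≤ ∑ _i : Fin m, ∑ _j : Fin n, 2 * ((σ : ℝ) + 1) ^ 2 :=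
        Finset.sum_le_sum fun i _ => Finset.sum_le_sum fun j _ => hent i j
    _ = _ := by
        simp only [Finset.sum_const, Finset.card_univ, Fintype.card_fin, nsmul_eq_mul]
        ring

lemma IsImputable.integrable_spectralNorm₂_noise (h : IsImputable μ X O M p σ r δ) :
    Integrable (fun ω => spectralNorm₂ (noise X O M p ω)) μ := by
  refine (h.integrable_frobeniusSq_noise.add (integrable_const 1)).mono'
    h.measurable_spectralNorm₂_noise.aestronglyMeasurable (Eventually.of_forall fun ω => ?_)
  rw [Real.norm_of_nonneg (spectralNorm₂_nonneg _)]
  have := spectralNorm₂_sq_le_frobeniusSq (noise X O M p ω)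
  simp only [Pi.add_apply]
  nlinarith [sq_nonneg (spectralNorm₂ (noise X O M p ω) - 1),
    spectralNorm₂_nonneg (noise X O M p ω)]

/-- The expected spectral norm of the noise is of the optimal order `√(p n)`, without a logarithmic
factor. Here `k` is the exponent of the trace, of order `log n`. -/
lemma IsImputable.integral_spectralNorm₂_noise_le (h : IsImputable μ X O M p σ r δ) (hmn : m ≤ n)
    {j k : ℕ} (hj : j ≠ 0) (hkj : k = 2 * j) (hkp : (k : ℝ) * (k + 1) ≤ p * n)
    (hkn : 3 * (n : ℝ) ≤ Real.exp k) :
    ∫ ω, spectralNorm₂ (noise X O M p ω) ∂μ ≤ 10 ^ 6 * ((σ : ℝ) + 1) * √(p * n) := by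
  have hp := h.p_pos
  have hk2 : (2 : ℝ) ≤ k := by
    have : 2 ≤ k := by omega
    exact_mod_cast this
  have hk : (0 : ℝ) < k := by linarith
  set t : ℝ := (σ : ℝ) + 1 with ht
  have htpos : 0 < t := by positivity
  set s : ℝ := 2 * p / k with hs
  have hspos : 0 < s := by positivity
  have hs1 : s ≤ 1 := by
    rw [hs, div_le_one hk]
    linarith [h.p_le_one]
  set R : ℕ := ⌈s * n⌉₊ + k with hR
  have hR1 : s * n + k ≤ R := by
    rw [hR]
    push_cast
    linarith [Nat.le_ceil (s * n)]
  have hR2 : (R : ℝ) ≤ s * n + k + 1 := by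
    rw [hR]
    push_cast
    linarith [Nat.ceil_lt_add_one (show 0 ≤ s * n by positivity)]
  have hRm : s * m + k ≤ R := by
    refine le_trans ?_ hR1
    gcongr
  have hRpos : (0 : ℝ) < R := lt_of_lt_of_le (by positivity) hR1
  set D : ℝ := √(Real.exp 1 * (4 * (t ^ 2 * k) * (10 ^ 8 * R))) with hD
  have hD2 : D ^ 2 = Real.exp 1 * (4 * (t ^ 2 * k) * (10 ^ 8 * R)) := Real.sq_sqrt (by positivity)
  have hDpos : 0 < D := Real.sqrt_pos.2 (by positivity)
  have hsk : s * k = 2 * p := by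
    rw [hs]
    field_simp
  have hkR : k * (R : ℝ) ≤ 3 * (p * n) := by
    calc k * (R : ℝ) ≤ k * (s * n + k + 1) := by gcongr
      _ = (s * k) * n + k * (k + 1) := by ring
      _ ≤ 3 * (p * n) := by rw [hsk]; linarith
  have hexp : 2 * R / s ≤ Real.exp k := by
    rw [div_le_iff₀ hspos]
    have h1 : k * (k + 1) * s ≤ 2 * p * (s * n) := by
      calc k * (k + 1) * s ≤ (p * n) * s := by gcongr
        _ ≤ 2 * p * (s * n) := by nlinarith [mul_nonneg (mul_nonneg hp.le hspos.le) n.cast_nonneg]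
    have h2 : (k + 1 : ℝ) * 2 ≤ 2 * (s * n) := by
      have : (k + 1 : ℝ) * (2 * p) ≤ (s * n) * (2 * p) := by rw [← hsk]; nlinarith
      have := le_of_mul_le_mul_right this (by positivity)
      linarith
    nlinarith
  have hmain := integral_spectralNorm₂_centred_le h.measurable_maskedEntry
    h.iIndepFun_maskedEntry h.integrable_maskedEntry_pow hj hkj hspos hs1
    (K := t ^ 2 * k) (by positivity) (fun e q hq hqk => h.integral_maskedEntry_pow_le e hq hqk)
    hRm hR1 hDpos hD2 hexp
  simp_rw [← h.noise_eq] at hmain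
  refine hmain.trans ?_
  have hDle : D ≤ 10 ^ 5 * t * √(p * n) := by
    rw [hD]
    apply Real.sqrt_le_iff.2 ⟨by positivity, ?_⟩
    rw [mul_pow, Real.sq_sqrt (by positivity)]
    calc Real.exp 1 * (4 * (t ^ 2 * k) * (10 ^ 8 * R))
        = Real.exp 1 * (4 * 10 ^ 8 * t ^ 2) * (k * R) := by ring
      _ ≤ 3 * (4 * 10 ^ 8 * t ^ 2) * (3 * (p * n)) := by
          gcongr
          exact Real.exp_one_lt_three.le
      _ ≤ (10 ^ 5 * t) ^ 2 * (p * n) := by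
          have : 0 ≤ t ^ 2 * (p * n) := by positivity
          nlinarith
  have : 0 ≤ t * √(p * n) := by positivity
  nlinarith

end Model

/-! ### The observed fraction -/

section ObservedFraction

variable {Ω : Type*} {m n : ℕ} {X : Matrix (Fin m) (Fin n) (Ω → ℝ)}
  {O : Matrix (Fin m) (Fin n) (Ω → Bool)}

lemma obsIndicator_nonneg (e : Fin m × Fin n) (ω : Ω) : 0 ≤ obsIndicator O e ω := by
  unfold obsIndicator; split_ifs <;> norm_num

lemma obsIndicator_le_one (e : Fin m × Fin n) (ω : Ω) : obsIndicator O e ω ≤ 1 := by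
  unfold obsIndicator; split_ifs <;> norm_num

/-- The number of observed entries. -/
def obsCount (O : Matrix (Fin m) (Fin n) (Ω → Bool)) (ω : Ω) : ℝ := ∑ e, obsIndicator O e ω

lemma obsCount_nonneg (ω : Ω) : 0 ≤ obsCount O ω :=
  Finset.sum_nonneg fun e _ => obsIndicator_nonneg e ω

lemma obsCount_le (ω : Ω) : obsCount O ω ≤ (m : ℝ) * n := by
  calc obsCount O ω ≤ ∑ _e : Fin m × Fin n, (1 : ℝ) :=
        Finset.sum_le_sum fun e _ => obsIndicator_le_one e ω
    _ = (m : ℝ) * n := by simp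

variable [MeasurableSpace Ω] {μ : Measure Ω} {M : Matrix (Fin m) (Fin n) ℝ} {p : ℝ} {σ : ℝ≥0}
  {r δ : ℝ}

lemma IsImputable.measurable_obsCount (h : IsImputable μ X O M p σ r δ) :
    Measurable (obsCount O) :=
  Finset.measurable_sum _ fun e _ => h.measurable_obsIndicator e

/-- The event that fewer than half of the expected number of entries is observed. -/
def sparseEvent (O : Matrix (Fin m) (Fin n) (Ω → Bool)) (p : ℝ) : Set Ω :=
  {ω | obsCount O ω < p * (m * n) / 2}

lemma IsImputable.measurableSet_sparseEvent (h : IsImputable μ X O M p σ r δ) :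
    MeasurableSet (sparseEvent O p) :=
  measurableSet_lt h.measurable_obsCount measurable_const

variable [IsProbabilityMeasure μ]

lemma IsImputable.memLp_obsIndicator (h : IsImputable μ X O M p σ r δ) (e : Fin m × Fin n) :
    MemLp (obsIndicator O e) 2 μ := by
  refine MemLp.of_bound (h.measurable_obsIndicator e).aestronglyMeasurable 1
    (Eventually.of_forall fun ω => ?_)
  rw [Real.norm_of_nonneg (obsIndicator_nonneg e ω)]
  exact obsIndicator_le_one e ω

lemma IsImputable.integral_obsCount_sub_sq_le (h : IsImputable μ X O M p σ r δ) :
    Integrable (fun ω => (obsCount O ω - p * (m * n)) ^ 2) μ ∧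
      ∫ ω, (obsCount O ω - p * (m * n)) ^ 2 ∂μ ≤ p * (m * n) := by
  have heq : obsCount O = ∑ e, obsIndicator O e := by
    ext ω
    simp [obsCount]
  have hL : MemLp (obsCount O) 2 μ := by
    rw [heq]
    exact memLp_finsetSum' _ fun e _ => h.memLp_obsIndicator e
  have hmean : ∫ ω, obsCount O ω ∂μ = p * (m * n) := by
    simp only [obsCount]
    rw [integral_finsetSum _ fun e _ => (h.memLp_obsIndicator e).integrable one_le_two]
    simp only [h.integral_obsIndicator]
    simp
    ring
  refine ⟨(hL.sub (memLp_const _)).integrable_sq, ?_⟩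
  have hvar : Var[obsCount O; μ] = ∑ e, Var[obsIndicator O e; μ] := by
    rw [heq]
    exact IndepFun.variance_sum (fun e _ => h.memLp_obsIndicator e)
      fun e _ e' _ hne => h.iIndepFun_obsIndicator.indepFun hne
  have hve : ∀ e, Var[obsIndicator O e; μ] ≤ p := by
    intro e
    refine (variance_le_expectation_sq (h.measurable_obsIndicator e).aestronglyMeasurable).trans ?_
    rw [← h.integral_obsIndicator e]
    refine integral_mono (h.memLp_obsIndicator e).integrable_sq
      ((h.memLp_obsIndicator e).integrable one_le_two) fun ω => ?_
    simp only [Pi.pow_apply]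
    nlinarith [obsIndicator_nonneg (O := O) e ω, obsIndicator_le_one (O := O) e ω]
  rw [← hmean, ← variance_eq_integral h.measurable_obsCount.aemeasurable, hvar]
  calc ∑ e, Var[obsIndicator O e; μ] ≤ ∑ _e : Fin m × Fin n, p :=
        Finset.sum_le_sum fun e _ => hve e
    _ = ∫ ω, obsCount O ω ∂μ := by
        rw [hmean]
        simp
        ring

lemma IsImputable.integral_exp_neg_obsCount_le (h : IsImputable μ X O M p σ r δ) :
    ∫ ω, Real.exp (-obsCount O ω) ∂μ ≤ Real.exp (-(3 / 5 * (p * (m * n)))) := by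
  have h1 : ∀ ω, Real.exp (-obsCount O ω) = ∏ e, Real.exp (-obsIndicator O e ω) := by
    intro ω
    rw [obsCount, ← Finset.sum_neg_distrib, Real.exp_sum]
  have he : Real.exp (-1) ≤ 2 / 5 := by
    rw [Real.exp_neg, inv_le_comm₀ (Real.exp_pos _) (by norm_num)]
    linarith [Real.exp_one_gt_d9]
  have h2 : ∀ e, ∫ ω, Real.exp (-obsIndicator O e ω) ∂μ ≤ Real.exp (-(3 / 5 * p)) := by
    intro e
    have hint := (h.memLp_obsIndicator e).integrable one_le_two
    calc ∫ ω, Real.exp (-obsIndicator O e ω) ∂μ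
        ≤ ∫ ω, (1 - 3 / 5 * obsIndicator O e ω) ∂μ := by
          refine integral_mono_of_nonneg (Eventually.of_forall fun ω => (Real.exp_pos _).le)
            ((integrable_const 1).sub (hint.const_mul _)) (Eventually.of_forall fun ω => ?_)
          simp only [obsIndicator]
          split_ifs
          · linarith
          · simp
      _ = 1 - 3 / 5 * p := by
          rw [integral_sub (integrable_const 1) (hint.const_mul _), integral_const_mul,
            h.integral_obsIndicator]
          simp
      _ ≤ Real.exp (-(3 / 5 * p)) := by
          linarith [Real.add_one_le_exp (-(3 / 5 * p))]
  simp_rw [h1]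
  rw [h.iIndepFun_obsIndicator.integral_fun_prod_comp (f := fun _ x => Real.exp (-x))
    (fun e => (h.measurable_obsIndicator e).aemeasurable) fun e => by fun_prop]
  calc ∏ e, ∫ ω, Real.exp (-obsIndicator O e ω) ∂μ
      ≤ ∏ _e : Fin m × Fin n, Real.exp (-(3 / 5 * p)) :=
        Finset.prod_le_prod (fun e _ => integral_nonneg fun ω => (Real.exp_pos _).le)
          fun e _ => h2 e
    _ = Real.exp (-(3 / 5 * (p * (m * n)))) := by
        rw [Finset.prod_const, ← Real.exp_nat_mul]
        simp
        ring

/-- A Chernoff bound. -/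
lemma IsImputable.measureReal_sparseEvent_le (h : IsImputable μ X O M p σ r δ) :
    μ.real (sparseEvent O p) ≤ Real.exp (-(p * (m * n) / 10)) := by
  have hint : Integrable (fun ω => Real.exp (-obsCount O ω)) μ := by
    refine Integrable.of_bound (h.measurable_obsCount.neg.exp).aestronglyMeasurable 1
      (Eventually.of_forall fun ω => ?_)
    rw [Real.norm_of_nonneg (Real.exp_pos _).le, Real.exp_le_one_iff]
    linarith [obsCount_nonneg (O := O) ω]
  rw [← integral_indicator_one h.measurableSet_sparseEvent]
  calc ∫ ω, (sparseEvent O p).indicator 1 ω ∂μ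
      ≤ ∫ ω, Real.exp (p * (m * n) / 2) * Real.exp (-obsCount O ω) ∂μ := by
        refine integral_mono_of_nonneg
          (Eventually.of_forall fun ω => Set.indicator_nonneg (fun _ _ => zero_le_one) ω)
          (hint.const_mul _) (Eventually.of_forall fun ω => ?_)
        by_cases hω : ω ∈ sparseEvent O p
        · rw [Set.indicator_of_mem hω, Pi.one_apply]
          dsimp only
          rw [← Real.exp_add, Real.one_le_exp_iff]
          have : obsCount O ω < p * (m * n) / 2 := hω
          linarith
        · rw [Set.indicator_of_notMem hω]
          positivity
    _ ≤ Real.exp (p * (m * n) / 2) * Real.exp (-(3 / 5 * (p * (m * n)))) := by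
        rw [integral_const_mul]
        gcongr
        exact h.integral_exp_neg_obsCount_le
    _ = Real.exp (-(p * (m * n) / 10)) := by
        rw [← Real.exp_add]
        congr 1
        ring

end ObservedFraction

/-! ### The imputation error for a fixed size -/

section FixedSize

lemma nuclearNorm_smul_le {m n : ℕ} (M A : Matrix (Fin m) (Fin n) ℝ) {p : ℝ} (hp : 0 ≤ p) :
    nuclearNorm (p • M) ≤
      p * (√(A.rank) * √(frobeniusSq A) + √m * √(frobeniusSq (M - A))) := by
  have hf : ∀ B : Matrix (Fin m) (Fin n) ℝ, √(frobeniusSq (p • B)) = p * √(frobeniusSq B) := by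
    intro B
    have : frobeniusSq (p • B) = p ^ 2 * frobeniusSq B := by
      simp only [frobeniusSq, Matrix.smul_apply, smul_eq_mul, mul_pow, Finset.mul_sum]
    rw [this, Real.sqrt_mul (sq_nonneg p), Real.sqrt_sq hp]
  have hr : √((p • A).rank : ℝ) ≤ √(A.rank) := by
    have h := Matrix.rank_mul_le_right (p • (1 : Matrix (Fin m) (Fin m) ℝ)) A
    rw [Matrix.smul_mul, Matrix.one_mul] at h
    exact Real.sqrt_le_sqrt (by exact_mod_cast h)
  have h := nuclearNorm_le (p • M) (p • A)
  rw [← smul_sub, hf, hf] at h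
  refine h.trans ?_
  calc _ ≤ √(A.rank) * (p * √(frobeniusSq A)) + √m * (p * √(frobeniusSq (M - A))) := by
        gcongr
    _ = _ := by ring

lemma nuclearNorm_nonneg {m n : ℕ} (A : Matrix (Fin m) (Fin n) ℝ) : 0 ≤ nuclearNorm A :=
  Finset.sum_nonneg fun i _ => LinearMap.singularValues_nonneg _ i

variable {Ω : Type*} [MeasurableSpace Ω] {μ : Measure Ω} {m n : ℕ}
  {X : Matrix (Fin m) (Fin n) (Ω → ℝ)} {O : Matrix (Fin m) (Fin n) (Ω → Bool)}
  {M : Matrix (Fin m) (Fin n) ℝ} {p : ℝ} {σ : ℝ≥0} {r δ : ℝ}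

/-- Bounds for the estimated observation probability `h`. Outside the sparse event it is at least
`p / 2`; on the sparse event only `h ≥ 1 / (m n)` is available. -/
lemma IsImputable.observedFraction_bounds (hI : IsImputable μ X O M p σ r δ)
    (hmn : (1 : ℝ) ≤ m * n) (ω : Ω) :
    let h := observedFraction (dataMatrix X O ω)
    0 < h ∧
    1 / h ^ 2 ≤ 4 / p ^ 2 + ((m : ℝ) * n) ^ 2 * (sparseEvent O p).indicator 1 ω ∧
    (h - p) ^ 2 ≤ 1 ∧
    (h - p) ^ 2 ≤ 2 * (obsCount O ω - p * (m * n)) ^ 2 / ((m : ℝ) * n) ^ 2 +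
      2 / ((m : ℝ) * n) ^ 2 := by
  intro h
  set N : ℝ := (m : ℝ) * n with hN
  have hNpos : 0 < N := by linarith
  have hp := hI.p_pos
  have hp1 := hI.p_le_one
  have hh : h = max (obsCount O ω / N) (1 / N) := observedFraction_dataMatrix ω
  have hlow : 1 / N ≤ h := hh ▸ le_max_right _ _
  have hlow2 : obsCount O ω / N ≤ h := hh ▸ le_max_left _ _
  have hpos : 0 < h := lt_of_lt_of_le (by positivity) hlow
  have hup : h ≤ 1 := by
    rw [hh]
    refine max_le ?_ ?_
    · rw [div_le_one hNpos]; exact obsCount_le ω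
    · rw [div_le_one hNpos]; exact hmn
  refine ⟨hpos, ?_, ?_, ?_⟩
  · by_cases hω : ω ∈ sparseEvent O p
    · rw [Set.indicator_of_mem hω, Pi.one_apply, mul_one]
      have h1 : 1 / h ≤ N := by
        rw [div_le_iff₀ hpos]
        rw [div_le_iff₀ hNpos] at hlow
        linarith
      have h2 : 1 / h ^ 2 ≤ N ^ 2 := by
        rw [← one_div_pow]
        exact pow_le_pow_left₀ (by positivity) h1 2
      have h3 : 0 ≤ 4 / p ^ 2 := by positivity
      linarith
    · rw [Set.indicator_of_notMem hω, mul_zero, add_zero]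
      have h1 : p * N / 2 ≤ obsCount O ω := not_lt.1 hω
      have h2 : p / 2 ≤ h := by
        refine le_trans ?_ hlow2
        rw [le_div_iff₀ hNpos]
        linarith
      calc 1 / h ^ 2 ≤ 1 / (p / 2) ^ 2 := by gcongr
        _ = 4 / p ^ 2 := by field_simp; norm_num
  · nlinarith
  · have h1 : |h - p| ≤ |obsCount O ω / N - p| + 1 / N := by
      have hq0 : 0 ≤ obsCount O ω / N := div_nonneg (obsCount_nonneg ω) hNpos.le
      have hN0 : 0 < 1 / N := by positivity
      rw [abs_le]
      constructor
      · linarith [neg_abs_le (obsCount O ω / N - p)]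
      · rw [hh]
        rcases max_cases (obsCount O ω / N) (1 / N) with ⟨hm, _⟩ | ⟨hm, _⟩ <;> rw [hm]
        · linarith [le_abs_self (obsCount O ω / N - p)]
        · linarith [abs_nonneg (obsCount O ω / N - p)]
    have h2 : (obsCount O ω / N - p) ^ 2 = (obsCount O ω - p * N) ^ 2 / N ^ 2 := by
      rw [← div_pow]
      congr 1
      field_simp
    calc (h - p) ^ 2 = |h - p| ^ 2 := (sq_abs _).symm
      _ ≤ (|obsCount O ω / N - p| + 1 / N) ^ 2 := pow_le_pow_left₀ (abs_nonneg _) h1 2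
      _ ≤ 2 * |obsCount O ω / N - p| ^ 2 + 2 * (1 / N) ^ 2 := by
          nlinarith [sq_nonneg (|obsCount O ω / N - p| - 1 / N)]
      _ = _ := by
          rw [sq_abs, h2, one_div_pow]
          ring

variable [IsProbabilityMeasure μ]

lemma IsImputable.nuclearNorm_smul_mean_le (h : IsImputable μ X O M p σ r δ) (hδ : 0 ≤ δ) :
    nuclearNorm (p • M) ≤
      p * (√r * (2 * ((σ : ℝ) + 1 + δ)) + √m * δ) * √(m * n) := by
  obtain ⟨A, hA, hMA⟩ := h.low_rank
  have hp := h.p_pos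
  have h1 : frobeniusSq (M - A) ≤ δ ^ 2 * (m * n) := by
    calc frobeniusSq (M - A) ≤ ∑ _i : Fin m, ∑ _j : Fin n, δ ^ 2 := by
          refine Finset.sum_le_sum fun i _ => Finset.sum_le_sum fun j _ => ?_
          rw [Matrix.sub_apply, ← sq_abs]
          exact pow_le_pow_left₀ (abs_nonneg _) (hMA i j) 2
      _ = _ := by
          simp only [Finset.sum_const, Finset.card_univ, Fintype.card_fin, nsmul_eq_mul]
          ring
  have h2 : frobeniusSq A ≤ (2 * ((σ : ℝ) + 1 + δ)) ^ 2 * (m * n) := by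
    have hpt : frobeniusSq A ≤ 2 * frobeniusSq M + 2 * frobeniusSq (M - A) := by
      simp only [frobeniusSq, Finset.mul_sum, ← Finset.sum_add_distrib]
      refine Finset.sum_le_sum fun i _ => Finset.sum_le_sum fun j _ => ?_
      rw [Matrix.sub_apply]
      nlinarith [sq_nonneg (2 * M i j - A i j)]
    have h3 := h.frobeniusSq_mean_le
    have hmn : (0 : ℝ) ≤ m * n := by positivity
    have hσ : (0 : ℝ) ≤ (σ : ℝ) + 1 := by positivity
    calc frobeniusSq A ≤ 2 * (2 * ((σ : ℝ) + 1) ^ 2 * (m * n)) + 2 * (δ ^ 2 * (m * n)) := by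
          linarith
      _ ≤ _ := by nlinarith [mul_nonneg (mul_nonneg hσ hδ) hmn, mul_nonneg (sq_nonneg δ) hmn]
  have h3 : √(frobeniusSq (M - A)) ≤ δ * √(m * n) := by
    refine Real.sqrt_le_iff.2 ⟨by positivity, ?_⟩
    rwa [mul_pow, Real.sq_sqrt (by positivity)]
  have h4 : √(frobeniusSq A) ≤ 2 * ((σ : ℝ) + 1 + δ) * √(m * n) := by
    refine Real.sqrt_le_iff.2 ⟨by positivity, ?_⟩
    rwa [mul_pow, Real.sq_sqrt (by positivity)]
  calc nuclearNorm (p • M)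
      ≤ p * (√(A.rank) * √(frobeniusSq A) + √m * √(frobeniusSq (M - A))) :=
        nuclearNorm_smul_le M A hp.le
    _ ≤ p * (√r * (2 * ((σ : ℝ) + 1 + δ) * √(m * n)) + √m * (δ * √(m * n))) := by
        gcongr
    _ = _ := by ring

/-- The algebra behind the error decomposition: `x` stands for an estimated entry, `y` for the true
one, `h` for the estimated observation probability. -/
lemma sq_sub_le_of_scaled {h p x y : ℝ} (hh : 0 < h) :
    (x - y) ^ 2 ≤ 2 / h ^ 2 * (h * x - p * y) ^ 2 + 2 * (h - p) ^ 2 / h ^ 2 * y ^ 2 := by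
  have e : h ^ 2 * (x - y) ^ 2 = ((h * x - p * y) - (h - p) * y) ^ 2 := by ring
  have : h ^ 2 * (x - y) ^ 2 ≤ 2 * (h * x - p * y) ^ 2 + 2 * (h - p) ^ 2 * y ^ 2 := by
    rw [e]
    nlinarith [sq_nonneg ((h * x - p * y) + (h - p) * y)]
  rw [div_mul_eq_mul_div, div_mul_eq_mul_div, ← add_div, le_div_iff₀ (by positivity)]
  linarith

lemma frobeniusSq_sub_le_of_scaled {m n : ℕ} (B M : Matrix (Fin m) (Fin n) ℝ) {h p : ℝ}
    (hh : 0 < h) :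
    frobeniusSq (B - M) ≤ 2 / h ^ 2 * frobeniusSq (h • B - p • M) +
      2 * (h - p) ^ 2 / h ^ 2 * frobeniusSq M := by
  simp only [frobeniusSq, Finset.mul_sum, ← Finset.sum_add_distrib]
  exact Finset.sum_le_sum fun i _ => Finset.sum_le_sum fun j _ => sq_sub_le_of_scaled hh

/-- The mean squared error, in terms of the expected norm `a` of the noise, the nuclear norm and the
Frobenius norm of the mean matrix, if the sparse event is very unlikely. -/
lemma IsImputable.lintegral_frobeniusSq_le (hI : IsImputable μ X O M p σ r δ)
    (ME : MatrixEstimator) {C₁ ζ : ℝ} (hG : EstimationGuarantee ME C₁ ζ μ X O M p)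
    (hpζ : (max m n : ℝ) ^ (-1 + ζ) ≤ p) (hmn : (1 : ℝ) ≤ m * n)
    (hsmall : ((m : ℝ) * n) ^ 5 * Real.exp (-(p * (m * n) / 10)) ≤ 1)
    {a : ℝ} (ha : ∫ ω, spectralNorm₂ (noise X O M p ω) ∂μ ≤ a) :
    ∫⁻ ω, ENNReal.ofReal (frobeniusSq (ME.est m n (dataMatrix X O ω) - M)) ∂μ ≤
      ENNReal.ofReal (2 * |C₁| * nuclearNorm (p • M) *
          (4 / p ^ 2 * a + 2 * ((σ : ℝ) + 1) ^ 2 + 1) +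
        2 * frobeniusSq M * (8 / (p * (m * n)) + 8 / (p * (m * n)) ^ 2 +
          1 / ((m : ℝ) * n) ^ 3)) := by
  set N : ℝ := (m : ℝ) * n with hN
  have hNpos : 0 < N := by linarith
  have hp := hI.p_pos
  set B := sparseEvent O p with hB
  set F := frobeniusSq M with hF
  have hF0 : 0 ≤ F := frobeniusSq_nonneg M
  set ν := nuclearNorm (p • M) with hν
  have hν0 : 0 ≤ ν := nuclearNorm_nonneg _
  set s : Ω → ℝ := fun ω => spectralNorm₂ (noise X O M p ω) with hs
  set φ : Ω → ℝ := fun ω => frobeniusSq (noise X O M p ω) with hφ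
  set d : Ω → ℝ := fun ω => (obsCount O ω - p * N) ^ 2 with hd
  set χ : Ω → ℝ := B.indicator 1 with hχ
  have hχ0 : ∀ ω, 0 ≤ χ ω := fun ω => Set.indicator_nonneg (fun _ _ => zero_le_one) ω
  have hχ1 : ∀ ω, χ ω = 0 ∨ χ ω = 1 := fun ω => by
    by_cases h : ω ∈ B
    · right; simp [hχ, h]
    · left; simp [hχ, h]
  -- on the sparse event, `s ≤ N⁻³ s² + N³ / 4`
  set g : Ω → ℝ := fun ω =>
    2 * |C₁| * ν * (4 / p ^ 2 * s ω + N ^ 2 * (1 / N ^ 3 * φ ω + N ^ 3 / 4 * χ ω)) +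
      2 * F * (4 / p ^ 2 * (2 / N ^ 2 * d ω + 2 / N ^ 2) + N ^ 2 * χ ω) with hg
  have hsi : Integrable s μ := hI.integrable_spectralNorm₂_noise
  have hφi : Integrable φ μ := hI.integrable_frobeniusSq_noise
  have hdi : Integrable d μ := hI.integral_obsCount_sub_sq_le.1
  have hdle : ∫ ω, d ω ∂μ ≤ p * N := hI.integral_obsCount_sub_sq_le.2
  have hχi : Integrable χ μ :=
    (integrable_const (1 : ℝ)).indicator hI.measurableSet_sparseEvent
  have hi1 : Integrable (fun ω => 1 / N ^ 3 * φ ω + N ^ 3 / 4 * χ ω) μ :=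
    (hφi.const_mul _).add (hχi.const_mul _)
  have hi2 : Integrable (fun ω => 4 / p ^ 2 * s ω +
      N ^ 2 * (1 / N ^ 3 * φ ω + N ^ 3 / 4 * χ ω)) μ := (hsi.const_mul _).add (hi1.const_mul _)
  have hi3 : Integrable (fun ω => 2 / N ^ 2 * d ω + 2 / N ^ 2) μ :=
    (hdi.const_mul _).add (integrable_const _)
  have hi4 : Integrable (fun ω => 4 / p ^ 2 * (2 / N ^ 2 * d ω + 2 / N ^ 2) + N ^ 2 * χ ω) μ :=
    (hi3.const_mul _).add (hχi.const_mul _)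
  have hgi : Integrable g μ := (hi2.const_mul _).add (hi4.const_mul _)
  have hpt : ∀ᵐ ω ∂μ, frobeniusSq (ME.est m n (dataMatrix X O ω) - M) ≤ g ω := by
    filter_upwards [hG hpζ] with ω hω
    obtain ⟨hh, hb1, hb2, hb3⟩ := hI.observedFraction_bounds hmn ω
    set h := observedFraction (dataMatrix X O ω)
    have hs0 : 0 ≤ s ω := spectralNorm₂_nonneg _
    have hω' : frobeniusSq (h • ME.est m n (dataMatrix X O ω) - p • M) ≤ |C₁| * s ω * ν := by
      refine hω.trans ?_
      have : C₁ * s ω * ν ≤ |C₁| * s ω * ν := by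
        gcongr
        exact le_abs_self C₁
      exact this
    have hsφ : χ ω * s ω ≤ 1 / N ^ 3 * φ ω + N ^ 3 / 4 * χ ω := by
      have hsq : s ω ^ 2 ≤ φ ω := spectralNorm₂_sq_le_frobeniusSq _
      have hN3 : 0 < N ^ 3 := by positivity
      have hφ0 : 0 ≤ φ ω := frobeniusSq_nonneg _
      rcases hχ1 ω with h0 | h0 <;> rw [h0]
      · have : 0 ≤ 1 / N ^ 3 * φ ω := by positivity
        linarith
      · have h5 : s ω ≤ 1 / N ^ 3 * s ω ^ 2 + N ^ 3 / 4 := by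
          have : 1 / N ^ 3 * s ω ^ 2 + N ^ 3 / 4 - s ω = (s ω - N ^ 3 / 2) ^ 2 / N ^ 3 := by
            field_simp
            ring
          have h6 : 0 ≤ (s ω - N ^ 3 / 2) ^ 2 / N ^ 3 := by positivity
          linarith
        have h7 : 1 / N ^ 3 * s ω ^ 2 ≤ 1 / N ^ 3 * φ ω := by gcongr
        linarith
    have h1 : 2 / h ^ 2 * frobeniusSq (h • ME.est m n (dataMatrix X O ω) - p • M) ≤
        2 * |C₁| * ν * (4 / p ^ 2 * s ω + N ^ 2 * (1 / N ^ 3 * φ ω + N ^ 3 / 4 * χ ω)) := by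
      calc 2 / h ^ 2 * frobeniusSq (h • ME.est m n (dataMatrix X O ω) - p • M)
          ≤ 2 / h ^ 2 * (|C₁| * s ω * ν) := by gcongr
        _ = 2 * |C₁| * ν * (1 / h ^ 2 * s ω) := by ring
        _ ≤ 2 * |C₁| * ν * ((4 / p ^ 2 + N ^ 2 * χ ω) * s ω) := by gcongr
        _ = 2 * |C₁| * ν * (4 / p ^ 2 * s ω + N ^ 2 * (χ ω * s ω)) := by ring
        _ ≤ _ := by gcongr
    have h2 : 2 * (h - p) ^ 2 / h ^ 2 * F ≤
        2 * F * (4 / p ^ 2 * (2 / N ^ 2 * d ω + 2 / N ^ 2) + N ^ 2 * χ ω) := by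
      have h3 : (h - p) ^ 2 ≤ 2 / N ^ 2 * d ω + 2 / N ^ 2 := by
        refine hb3.trans (le_of_eq ?_)
        rw [hd]
        ring
      have hχω := hχ0 ω
      calc 2 * (h - p) ^ 2 / h ^ 2 * F = 2 * F * ((h - p) ^ 2 * (1 / h ^ 2)) := by ring
        _ ≤ 2 * F * ((h - p) ^ 2 * (4 / p ^ 2 + N ^ 2 * χ ω)) := by gcongr
        _ = 2 * F * (4 / p ^ 2 * (h - p) ^ 2 + (h - p) ^ 2 * (N ^ 2 * χ ω)) := by ring
        _ ≤ 2 * F * (4 / p ^ 2 * (2 / N ^ 2 * d ω + 2 / N ^ 2) + 1 * (N ^ 2 * χ ω)) := by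
            gcongr
        _ = _ := by rw [one_mul]
    exact (frobeniusSq_sub_le_of_scaled _ M (p := p) hh).trans (add_le_add h1 h2)
  have hg0 : ∀ᵐ ω ∂μ, 0 ≤ g ω := by
    filter_upwards [hpt] with ω hω
    exact (frobeniusSq_nonneg _).trans hω
  calc ∫⁻ ω, ENNReal.ofReal (frobeniusSq (ME.est m n (dataMatrix X O ω) - M)) ∂μ
      ≤ ∫⁻ ω, ENNReal.ofReal (g ω) ∂μ :=
        lintegral_mono_ae (hpt.mono fun ω hω => ENNReal.ofReal_le_ofReal hω)
    _ = ENNReal.ofReal (∫ ω, g ω ∂μ) := (ofReal_integral_eq_lintegral_ofReal hgi hg0).symm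
    _ ≤ _ := by
      apply ENNReal.ofReal_le_ofReal
      have hP : ∫ ω, χ ω ∂μ ≤ 1 / N ^ 5 := by
        rw [hχ, integral_indicator_one hI.measurableSet_sparseEvent]
        refine hI.measureReal_sparseEvent_le.trans ?_
        rw [le_div_iff₀ (by positivity)]
        linarith
      have hφle : ∫ ω, φ ω ∂μ ≤ 2 * ((σ : ℝ) + 1) ^ 2 * N := hI.integral_frobeniusSq_noise_le
      have hval : ∫ ω, g ω ∂μ =
          2 * |C₁| * ν * (4 / p ^ 2 * ∫ ω, s ω ∂μ +
            N ^ 2 * (1 / N ^ 3 * ∫ ω, φ ω ∂μ + N ^ 3 / 4 * ∫ ω, χ ω ∂μ)) +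
          2 * F * (4 / p ^ 2 * (2 / N ^ 2 * ∫ ω, d ω ∂μ + 2 / N ^ 2) + N ^ 2 * ∫ ω, χ ω ∂μ) := by
        rw [hg, integral_add (hi2.const_mul _) (hi4.const_mul _), integral_const_mul,
          integral_const_mul, integral_add (hsi.const_mul _) (hi1.const_mul _),
          integral_add (hi3.const_mul _) (hχi.const_mul _), integral_const_mul,
          integral_const_mul, integral_const_mul, integral_const_mul,
          integral_add (hφi.const_mul _) (hχi.const_mul _),
          integral_add (hdi.const_mul _) (integrable_const _), integral_const_mul,
          integral_const_mul, integral_const_mul]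
        simp
      rw [hval]
      have e1 : N ^ 2 * (1 / N ^ 3 * ∫ ω, φ ω ∂μ + N ^ 3 / 4 * ∫ ω, χ ω ∂μ) ≤
          2 * ((σ : ℝ) + 1) ^ 2 + 1 := by
        calc _ ≤ N ^ 2 * (1 / N ^ 3 * (2 * ((σ : ℝ) + 1) ^ 2 * N) + N ^ 3 / 4 * (1 / N ^ 5)) := by
              gcongr
          _ = 2 * ((σ : ℝ) + 1) ^ 2 + 1 / 4 := by field_simp
          _ ≤ _ := by linarith
      have e2 : 4 / p ^ 2 * (2 / N ^ 2 * ∫ ω, d ω ∂μ + 2 / N ^ 2) + N ^ 2 * ∫ ω, χ ω ∂μ ≤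
          8 / (p * N) + 8 / (p * N) ^ 2 + 1 / N ^ 3 := by
        calc _ ≤ 4 / p ^ 2 * (2 / N ^ 2 * (p * N) + 2 / N ^ 2) + N ^ 2 * (1 / N ^ 5) := by
              gcongr
          _ = _ := by field_simp; ring
      have e3 : 4 / p ^ 2 * ∫ ω, s ω ∂μ ≤ 4 / p ^ 2 * a := by gcongr
      refine add_le_add ?_ ?_
      · refine mul_le_mul_of_nonneg_left ?_ (by positivity)
        linarith
      · exact mul_le_mul_of_nonneg_left e2 (by positivity)

end FixedSize

/-! ### From series to Page matrices -/

section Series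

lemma sum_Icc_eq_sum_page (L N : ℕ) (h : ℕ → ℝ) :
    ∑ t ∈ Finset.Icc 1 (L * N), h t = ∑ i : Fin L, ∑ j : Fin N, h ((i : ℕ) + 1 + (j : ℕ) * L) := by
  have h1 : ∑ t ∈ Finset.Icc 1 (L * N), h t = ∑ s ∈ Finset.range (N * L), h (s + 1) := by
    rw [Finset.range_eq_Ico, Finset.sum_Ico_add' h 0 (N * L) 1, mul_comm]
    congr 1
  rw [h1, ← Fin.sum_univ_eq_sum_range (fun s => h (s + 1)), ← finProdFinEquiv.sum_comp,
    Fintype.sum_prod_type, Finset.sum_comm]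
  refine Finset.sum_congr rfl fun i _ => Finset.sum_congr rfl fun j _ => ?_
  congr 1
  simp only [finProdFinEquiv_apply_val]
  ring

lemma seriesOfMatrix_apply {L N : ℕ} (A : Matrix (Fin L) (Fin N) ℝ) (i : Fin L) (j : Fin N) :
    seriesOfMatrix A ((i : ℕ) + 1 + (j : ℕ) * L) = A i j := by
  have e : (i : ℕ) + 1 + (j : ℕ) * L - 1 = i + j * L := by omega
  have hL : 0 < L := i.pos
  have h1 : ((i : ℕ) + 1 + (j : ℕ) * L - 1) % L = i := by
    rw [e, Nat.add_mul_mod_self_right, Nat.mod_eq_of_lt i.2]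
  have h2 : ((i : ℕ) + 1 + (j : ℕ) * L - 1) / L = j := by
    rw [e, Nat.add_mul_div_right _ _ hL, Nat.div_eq_of_lt i.2, zero_add]
  rw [seriesOfMatrix, dif_pos ⟨by rw [h1]; exact i.2, by rw [h2]; exact j.2⟩]
  congr 1 <;> exact Fin.ext (by assumption)

lemma sum_sq_eq_frobeniusSq_page (L N : ℕ) (f : ℕ → ℝ) :
    ∑ t ∈ Finset.Icc 1 (L * N), f t ^ 2 = frobeniusSq (pageMatrix L N f) :=
  sum_Icc_eq_sum_page L N fun t => f t ^ 2

lemma imputationMSE_eq (ME : MatrixEstimator) {Ω : Type*} [MeasurableSpace Ω] (μ : Measure Ω)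
    (L N : ℕ) (X : ℕ → Ω → ℝ) (O : ℕ → Ω → Bool) (f : ℕ → ℝ) :
    imputationMSE ME μ L N X O f =
      (∫⁻ ω, ENNReal.ofReal (frobeniusSq
        (ME.est L N (dataMatrix (pageMatrix L N X) (pageMatrix L N O) ω) - pageMatrix L N f)) ∂μ) /
      ENNReal.ofReal (frobeniusSq (pageMatrix L N f)) := by
  rw [imputationMSE, sum_sq_eq_frobeniusSq_page]
  congr 2
  ext ω
  rw [sum_Icc_eq_sum_page]
  simp only [imputedSeries, seriesOfMatrix_apply, frobeniusSq, Matrix.sub_apply, pageMatrix,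
    Matrix.of_apply]

end Series

/-! ### Asymptotics -/

section Asymptotic

/-- A trace exponent of logarithmic order, as required by the bound on the noise. -/
lemma eventually_exists_trace_exponent {ζ : ℝ} (hζ : 0 < ζ) :
    ∀ᶠ N : ℕ in atTop, ∃ j k : ℕ, j ≠ 0 ∧ k = 2 * j ∧ (k : ℝ) * (k + 1) ≤ (N : ℝ) ^ ζ ∧
      3 * (N : ℝ) ≤ Real.exp k := by
  have hlog : ∀ᶠ x : ℝ in atTop, 2 * Real.log (3 * x) + 3 ≤ x ^ (ζ / 2) := by
    have h1 := (isLittleO_log_rpow_atTop (half_pos hζ)).bound (show (0 : ℝ) < 1 / 4 by norm_num)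
    have h2 := (tendsto_rpow_atTop (half_pos hζ)).eventually_ge_atTop (2 * (2 * Real.log 3 + 3))
    filter_upwards [h1, h2, eventually_ge_atTop 1] with x hx1 hx2 hx3
    rw [Real.norm_of_nonneg (Real.log_nonneg hx3),
      Real.norm_of_nonneg (Real.rpow_nonneg (by linarith) _)] at hx1
    rw [Real.log_mul (by norm_num) (by linarith)]
    linarith
  filter_upwards [tendsto_natCast_atTop_atTop.eventually hlog, eventually_ge_atTop 1] with N hN hN1
  have hN1' : (1 : ℝ) ≤ N := by exact_mod_cast hN1
  have hlpos : 0 < Real.log (3 * N) := Real.log_pos (by linarith)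
  refine ⟨⌈Real.log (3 * N)⌉₊, 2 * ⌈Real.log (3 * N)⌉₊, (Nat.ceil_pos.2 hlpos).ne', rfl, ?_, ?_⟩
  · have h1 : ((2 * ⌈Real.log (3 * N)⌉₊ : ℕ) : ℝ) ≤ 2 * Real.log (3 * N) + 2 := by
      push_cast
      linarith [Nat.ceil_lt_add_one hlpos.le]
    set k : ℝ := ((2 * ⌈Real.log (3 * N)⌉₊ : ℕ) : ℝ)
    have hk0 : 0 ≤ k := Nat.cast_nonneg _
    calc k * (k + 1) ≤ (2 * Real.log (3 * N) + 3) * (2 * Real.log (3 * N) + 3) := by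
          exact mul_le_mul (by linarith) (by linarith) (by linarith) (by linarith)
      _ ≤ (N : ℝ) ^ (ζ / 2) * (N : ℝ) ^ (ζ / 2) := by gcongr
      _ = (N : ℝ) ^ ζ := by
          rw [← Real.rpow_add (by linarith), add_halves]
  · calc 3 * (N : ℝ) = Real.exp (Real.log (3 * N)) := (Real.exp_log (by linarith)).symm
      _ ≤ _ := by
        rw [Real.exp_le_exp]
        push_cast
        linarith [Nat.le_ceil (Real.log (3 * N))]

lemma eventually_pow_mul_exp_le {ζ : ℝ} (hζ : 0 < ζ) :
    ∀ᶠ N : ℕ in atTop, (N : ℝ) ^ 10 * Real.exp (-((N : ℝ) ^ ζ / 10)) ≤ 1 := by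
  have h1 := tendsto_rpow_mul_exp_neg_mul_atTop_nhds_zero (10 / ζ) (1 / 10) (by norm_num)
  have h2 := (h1.comp (tendsto_rpow_atTop hζ)).comp (tendsto_natCast_atTop_atTop (R := ℝ))
  filter_upwards [h2.eventually_le_const one_pos] with N hN
  refine le_trans (le_of_eq ?_) hN
  simp only [Function.comp_apply]
  rw [← Real.rpow_mul (by positivity), mul_div_cancel₀ _ hζ.ne']
  congr 1
  · exact_mod_cast (Real.rpow_natCast (N : ℝ) 10).symm
  · congr 1
    ring

/-- The product of the orders of the nuclear norm of `p M`, of the noise and of `‖M‖ ^ (-2)`. -/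
lemma nuclear_mul_noise_eq {L N p l : ℝ} (hL : 0 < L) (hN : 0 < N) (hp : 0 < p) (hl : 0 ≤ l)
    (a₁ a₂ c : ℝ) :
    (p * a₂ * (√L * √l) * √(L * N)) * (a₁ * (√(p * N) / p ^ 2)) * (c / (L * N)) =
      a₂ * a₁ * c * √(l / p) := by
  have e1 : √(L * N) = √L * √N := Real.sqrt_mul hL.le _
  have e2 : √(p * N) = √p * √N := Real.sqrt_mul hp.le _
  have e3 : √(l / p) = √l / √p := Real.sqrt_div hl _
  have f1 : √L ^ 2 = L := Real.sq_sqrt hL.le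
  have f2 : √N ^ 2 = N := Real.sq_sqrt hN.le
  have f3 : √p ^ 2 = p := Real.sq_sqrt hp.le
  have g3 : 0 < √p := Real.sqrt_pos.2 hp
  have e4 : √p * p / p ^ 2 = 1 / √p := by
    rw [div_eq_div_iff (by positivity) g3.ne']
    linear_combination p * f3
  rw [e1, e2, e3]
  calc _ = a₂ * a₁ * c * √l * ((√L ^ 2 / L) * (√N ^ 2 / N)) * (√p * p / p ^ 2) := by ring
    _ = a₂ * a₁ * c * √l * (1 / √p) := by
        rw [f1, f2, div_self hL.ne', div_self hN.ne', mul_one, mul_one, e4]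
    _ = _ := by ring

/-- The bound on the relative error for a given size, in closed form: the product of the nuclear
norm of `p M`, of order `p √(L ℓ) √(L N)` with `ℓ = L ^ (-min (2 ε₁) ε₂)`, and of the noise, of order
`√(p N)`, is of order `p² ‖M‖² √(ℓ / p)`. -/
lemma IsImputable.relative_error_le {Ω : Type*} [MeasurableSpace Ω] {μ : Measure Ω}
    [IsProbabilityMeasure μ] {L N : ℕ} {X : Matrix (Fin L) (Fin N) (Ω → ℝ)}
    {O : Matrix (Fin L) (Fin N) (Ω → Bool)} {M : Matrix (Fin L) (Fin N) ℝ} {p : ℝ} {σ : ℝ≥0}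
    {C₁ C₅ C₆ ε₁ ε₂ c : ℝ} (hC₅ : 0 < C₅) (hC₆ : 0 < C₆) (hε₁ : 0 < ε₁) (hc : 0 < c)
    (hI : IsImputable μ X O M p σ (C₅ * (L : ℝ) ^ (1 - ε₂)) (C₆ * (L : ℝ) ^ (-ε₁)))
    (hL : 1 ≤ L) (hN : 1 ≤ N) (hpN : 1 ≤ p * N) (hF : (L : ℝ) * N ≤ c * frobeniusSq M) :
    (2 * |C₁| * nuclearNorm (p • M) *
          (4 / p ^ 2 * (10 ^ 6 * ((σ : ℝ) + 1) * √(p * N)) + 2 * ((σ : ℝ) + 1) ^ 2 + 1) +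
        2 * frobeniusSq M * (8 / (p * (L * N)) + 8 / (p * (L * N)) ^ 2 +
          1 / ((L : ℝ) * N) ^ 3)) / frobeniusSq M ≤
      2 * |C₁| * (2 * √C₅ * ((σ : ℝ) + 1 + C₆) + C₆) *
          (4 * 10 ^ 6 * ((σ : ℝ) + 1) + 2 * ((σ : ℝ) + 1) ^ 2 + 1) * c *
          √((L : ℝ) ^ (-min (2 * ε₁) ε₂) / p) +
        2 * (8 / (p * (L * N)) + 8 / (p * (L * N)) ^ 2 + 1 / ((L : ℝ) * N) ^ 3) := by
  have hp := hI.p_pos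
  have hp1 := hI.p_le_one
  have hL1 : (1 : ℝ) ≤ L := by exact_mod_cast hL
  have hN1 : (1 : ℝ) ≤ N := by exact_mod_cast hN
  have hL0 : (0 : ℝ) < L := by linarith
  have hN0 : (0 : ℝ) < N := by linarith
  set t : ℝ := (σ : ℝ) + 1 with ht
  have htpos : 0 < t := by positivity
  set F := frobeniusSq M with hFdef
  have hFpos : 0 < F := by
    by_contra hcon
    have h1 : c * F ≤ 0 := mul_nonpos_of_nonneg_of_nonpos hc.le (not_lt.1 hcon)
    have h2 : (0 : ℝ) < L * N := by positivity
    linarith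
  set δ : ℝ := C₆ * (L : ℝ) ^ (-ε₁) with hδ
  set l : ℝ := (L : ℝ) ^ (-min (2 * ε₁) ε₂) with hl
  have hl0 : 0 < l := Real.rpow_pos_of_pos hL0 _
  have hδl : δ ≤ C₆ * √l := by
    have h1 : (L : ℝ) ^ (-ε₁) ≤ √l := by
      apply Real.le_sqrt_of_sq_le
      rw [← Real.rpow_natCast, ← Real.rpow_mul hL0.le]
      apply Real.rpow_le_rpow_of_exponent_le hL1
      push_cast
      linarith [min_le_left (2 * ε₁) ε₂]
    exact mul_le_mul_of_nonneg_left h1 hC₆.le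
  have hδC : δ ≤ C₆ := by
    have h1 : (L : ℝ) ^ (-ε₁) ≤ 1 := Real.rpow_le_one_of_one_le_of_nonpos hL1 (by linarith)
    nlinarith
  have hδ0 : 0 ≤ δ := by positivity
  have hrank : √(C₅ * (L : ℝ) ^ (1 - ε₂)) ≤ √C₅ * (√L * √l) := by
    rw [← Real.sqrt_mul hL0.le, ← Real.sqrt_mul hC₅.le]
    apply Real.sqrt_le_sqrt
    gcongr
    rw [sub_eq_add_neg, Real.rpow_add hL0, Real.rpow_one]
    gcongr
    rw [hl]
    exact Real.rpow_le_rpow_of_exponent_le hL1 (by linarith [min_le_right (2 * ε₁) ε₂])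
  set a₂ : ℝ := 2 * √C₅ * (t + C₆) + C₆ with ha₂
  set a₁ : ℝ := 4 * 10 ^ 6 * t + 2 * t ^ 2 + 1 with ha₁
  have ha₁0 : 0 ≤ a₁ := by positivity
  have ha₂0 : 0 ≤ a₂ := by positivity
  have hnuc : nuclearNorm (p • M) ≤ p * a₂ * (√L * √l) * √(L * N) := by
    refine (hI.nuclearNorm_smul_mean_le hδ0).trans ?_
    calc p * (√(C₅ * (L : ℝ) ^ (1 - ε₂)) * (2 * (t + δ)) + √L * δ) * √(L * N)
        ≤ p * (√C₅ * (√L * √l) * (2 * (t + C₆)) + √L * (C₆ * √l)) * √(L * N) := by gcongr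
      _ = p * a₂ * (√L * √l) * √(L * N) := by rw [ha₂]; ring
  have hnoise : 4 / p ^ 2 * (10 ^ 6 * t * √(p * N)) + 2 * t ^ 2 + 1 ≤
      a₁ * (√(p * N) / p ^ 2) := by
    have h1 : 1 ≤ √(p * N) / p ^ 2 := by
      rw [le_div_iff₀ (by positivity), one_mul]
      exact (pow_le_one₀ hp.le hp1).trans (Real.one_le_sqrt.2 hpN)
    have h2 : 4 / p ^ 2 * (10 ^ 6 * t * √(p * N)) = 4 * 10 ^ 6 * t * (√(p * N) / p ^ 2) := by ring
    rw [h2, ha₁]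
    nlinarith [sq_nonneg t]
  have hFinv : 1 / F ≤ c / (L * N) := by
    rw [div_le_div_iff₀ hFpos (by positivity)]
    linarith
  have hsq := nuclear_mul_noise_eq hL0 hN0 hp hl0.le a₁ a₂ c
  rw [add_div]
  refine add_le_add ?_ (le_of_eq ?_)
  · have hν0 : 0 ≤ nuclearNorm (p • M) := nuclearNorm_nonneg _
    calc 2 * |C₁| * nuclearNorm (p • M) *
          (4 / p ^ 2 * (10 ^ 6 * t * √(p * N)) + 2 * t ^ 2 + 1) / F
        = 2 * |C₁| * (nuclearNorm (p • M) *
          (4 / p ^ 2 * (10 ^ 6 * t * √(p * N)) + 2 * t ^ 2 + 1) * (1 / F)) := by ring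
      _ ≤ 2 * |C₁| * ((p * a₂ * (√L * √l) * √(L * N)) * (a₁ * (√(p * N) / p ^ 2)) *
          (c / (L * N))) := by gcongr
      _ = 2 * |C₁| * a₂ * a₁ * c * √(l / p) := by rw [hsq]; ring
  · field_simp

end Asymptotic

theorem mainTheorem2 {Ω : Type*} [MeasurableSpace Ω] (μ : Measure Ω) [IsProbabilityMeasure μ]
    (ME : MatrixEstimator)
    -- the mean series, the noisy series, and, for each `T`, which times are observed
    (f : ℕ → ℝ) (X : ℕ → Ω → ℝ) (O : ℕ → ℕ → Ω → Bool)
    -- the number of rows and the observation probability, for each `T`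
    (L : ℕ → ℕ) (p : ℕ → ℝ)
    (σ : ℝ≥0) (C₁ ζ C₅ C₆ ε₁ ε₂ : ℝ)
    (hζ : ζ ∈ Set.Ioo (0 : ℝ) 1) (hC₅ : 0 < C₅) (hC₆ : 0 < C₆)
    (hε₁ : ε₁ ∈ Set.Ioo (0 : ℝ) 1) (hε₂ : ε₂ ∈ Set.Ioo (0 : ℝ) 1)
    (hL : ∀ᶠ T in atTop, 1 < L T ∧ L T ≤ numCols T (L T))
    (hME : ∀ᶠ T in atTop, EstimationGuarantee ME C₁ ζ μ
      (pageMatrix (L T) (numCols T (L T)) X) (pageMatrix (L T) (numCols T (L T)) (O T))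
      (pageMatrix (L T) (numCols T (L T)) f) (p T))
    (hpζ : ∀ᶠ T in atTop, (max (L T) (numCols T (L T)) : ℝ) ^ (-1 + ζ) ≤ p T)
    (himp : ∀ᶠ T in atTop, IsImputable μ
      (pageMatrix (L T) (numCols T (L T)) X) (pageMatrix (L T) (numCols T (L T)) (O T))
      (pageMatrix (L T) (numCols T (L T)) f) (p T) σ
      (C₅ * (L T : ℝ) ^ (1 - ε₂)) (C₆ * (L T : ℝ) ^ (-ε₁)))
    (hf : (fun T : ℕ => (T : ℝ)) =O[atTop] fun T : ℕ => ∑ t ∈ Finset.Icc 1 T, f t ^ 2)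
    (hp : (fun T : ℕ => (L T : ℝ) ^ (-min (2 * ε₁) ε₂)) =o[atTop] p) :
    Tendsto (fun T : ℕ => imputationMSE ME μ (L T) (numCols T (L T)) X (O T) f) atTop (𝓝 0) := by
  set N : ℕ → ℕ := fun T => numCols T (L T) with hNdef
  set m₀ : ℝ := min (2 * ε₁) ε₂ with hm₀
  have hm₀pos : 0 < m₀ := lt_min (by linarith [hε₁.1]) hε₂.1
  -- the number of rows tends to infinity because `L ^ (-m₀) = o(p)` and `p ≤ 1`
  have hl0 : Tendsto (fun T => (L T : ℝ) ^ (-m₀)) atTop (𝓝 0) := by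
    have hpO : p =O[atTop] fun _ : ℕ => (1 : ℝ) := by
      refine IsBigO.of_bound 1 ?_
      filter_upwards [himp] with T hI
      rw [Real.norm_of_nonneg hI.p_pos.le]
      simpa using hI.p_le_one
    exact (isLittleO_one_iff ℝ).1 (hp.trans_isBigO hpO)
  have hLtop : Tendsto L atTop atTop := by
    refine tendsto_atTop.2 fun K => ?_
    have hK : (0 : ℝ) < ((K : ℝ) + 1) ^ (-m₀) := Real.rpow_pos_of_pos (by positivity) _
    filter_upwards [hl0.eventually_lt_const hK, hL] with T hT hLT
    by_contra hcon
    have h0 : (0 : ℝ) < L T := by exact_mod_cast (zero_lt_one.trans hLT.1)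
    have h1 : (L T : ℝ) ≤ (K : ℝ) + 1 := by
      have : L T ≤ K + 1 := by omega
      exact_mod_cast this
    exact absurd (Real.rpow_le_rpow_of_nonpos h0 h1 (by linarith)) (not_le.2 hT)
  have hNtop : Tendsto N atTop atTop :=
    tendsto_atTop_mono' _ (hL.mono fun T h => h.2) hLtop
  have hLNtop : Tendsto (fun T => L T * N T) atTop atTop :=
    tendsto_atTop_mono' _ (hL.mono fun T h => Nat.le_mul_of_pos_left _ (by omega)) hNtop
  obtain ⟨c, hc, hfc⟩ := hf.exists_pos
  have hFlow : ∀ᶠ T in atTop,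
      (L T : ℝ) * N T ≤ c * frobeniusSq (pageMatrix (L T) (N T) f) := by
    filter_upwards [hLNtop.eventually hfc.bound] with T hT
    rw [sum_sq_eq_frobeniusSq_page, Real.norm_of_nonneg (frobeniusSq_nonneg _),
      Real.norm_of_nonneg (Nat.cast_nonneg _)] at hT
    exact_mod_cast hT
  have hpN : ∀ᶠ T in atTop, (N T : ℝ) ^ ζ ≤ p T * N T := by
    filter_upwards [hpζ, hL] with T hT hLT
    have hN0 : (0 : ℝ) < N T := by
      have : 0 < N T := by have := hLT.2; simp only [hNdef]; omega
      exact_mod_cast this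
    have hmax : (max (L T) (numCols T (L T)) : ℝ) = N T :=
      max_eq_right (by exact_mod_cast hLT.2)
    rw [hmax] at hT
    calc (N T : ℝ) ^ ζ = (N T : ℝ) ^ (-1 + ζ) * N T := by
          rw [← Real.rpow_add_one hN0.ne']
          congr 1
          ring
      _ ≤ p T * N T := by gcongr
  have hNζ : Tendsto (fun T => (N T : ℝ) ^ ζ) atTop atTop :=
    (tendsto_rpow_atTop hζ.1).comp (tendsto_natCast_atTop_atTop.comp hNtop)
  have hpLN : Tendsto (fun T => p T * ((L T : ℝ) * N T)) atTop atTop := by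
    refine tendsto_atTop_mono' _ ?_ hNζ
    filter_upwards [hpN, hL, himp] with T hT hLT hI
    have hL1 : (1 : ℝ) ≤ L T := by exact_mod_cast hLT.1.le
    have h0 : 0 ≤ p T * N T := mul_nonneg hI.p_pos.le (Nat.cast_nonneg _)
    nlinarith
  set A : ℝ := 2 * |C₁| * (2 * √C₅ * ((σ : ℝ) + 1 + C₆) + C₆) *
    (4 * 10 ^ 6 * ((σ : ℝ) + 1) + 2 * ((σ : ℝ) + 1) ^ 2 + 1) * c with hA
  set b : ℕ → ℝ := fun T => A * √((L T : ℝ) ^ (-m₀) / p T) +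
    2 * (8 / (p T * ((L T : ℝ) * N T)) + 8 / (p T * ((L T : ℝ) * N T)) ^ 2 +
      1 / ((L T : ℝ) * N T) ^ 3) with hb
  have hbound : ∀ᶠ T in atTop,
      imputationMSE ME μ (L T) (numCols T (L T)) X (O T) f ≤ ENNReal.ofReal (b T) := by
    filter_upwards [hL, hME, hpζ, himp, hFlow, hpN,
      hNtop.eventually (eventually_exists_trace_exponent hζ.1),
      hNtop.eventually (eventually_pow_mul_exp_le hζ.1)] with T hLT hG hpT hI hF hpNT hk hexp
    have hL1 : 1 ≤ L T := hLT.1.le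
    have hN1 : 1 ≤ N T := hL1.trans hLT.2
    have hL1' : (1 : ℝ) ≤ L T := by exact_mod_cast hL1
    have hN1' : (1 : ℝ) ≤ N T := by exact_mod_cast hN1
    have hLN1 : (1 : ℝ) ≤ (L T : ℝ) * N T := one_le_mul_of_one_le_of_one_le hL1' hN1'
    have hLN : (L T : ℝ) ≤ N T := by exact_mod_cast hLT.2
    have hpos := hI.p_pos
    have h1 : 1 ≤ p T * N T := (Real.one_le_rpow hN1' hζ.1.le).trans hpNT
    obtain ⟨j, k, hj, hkj, hk1, hk2⟩ := hk
    have hnoise := hI.integral_spectralNorm₂_noise_le hLT.2 hj hkj (hk1.trans hpNT) hk2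
    have hsmall : ((L T : ℝ) * N T) ^ 5 * Real.exp (-(p T * (L T * N T) / 10)) ≤ 1 := by
      refine le_trans ?_ hexp
      have h2 : (L T : ℝ) * N T ≤ (N T : ℝ) ^ 2 := by rw [sq]; gcongr
      have h3 : (N T : ℝ) ^ ζ ≤ p T * (L T * N T) := by
        refine hpNT.trans ?_
        have : 0 ≤ p T * N T := by positivity
        nlinarith
      calc _ ≤ ((N T : ℝ) ^ 2) ^ 5 * Real.exp (-((N T : ℝ) ^ ζ / 10)) := by gcongr
        _ = _ := by rw [← pow_mul]
    have hmse := hI.lintegral_frobeniusSq_le ME hG hpT hLN1 hsmall hnoise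
    have hrel := hI.relative_error_le (C₁ := C₁) hC₅ hC₆ hε₁.1 hc hL1 hN1 h1 hF
    have hFpos : 0 < frobeniusSq (pageMatrix (L T) (N T) f) := by
      by_contra hcon
      have := mul_nonpos_of_nonneg_of_nonpos hc.le (not_lt.1 hcon)
      linarith
    rw [imputationMSE_eq]
    refine (ENNReal.div_le_div_right hmse _).trans ?_
    rw [← ENNReal.ofReal_div_of_pos hFpos]
    exact ENNReal.ofReal_le_ofReal hrel
  have hblim : Tendsto b atTop (𝓝 0) := by
    have h1 : Tendsto (fun T => √((L T : ℝ) ^ (-m₀) / p T)) atTop (𝓝 0) := by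
      have := (Real.continuous_sqrt.tendsto 0).comp hp.tendsto_div_nhds_zero
      rwa [Real.sqrt_zero] at this
    have h2 : Tendsto (fun T => 8 / (p T * ((L T : ℝ) * N T))) atTop (𝓝 0) :=
      hpLN.const_div_atTop 8
    have h3 : Tendsto (fun T => 8 / (p T * ((L T : ℝ) * N T)) ^ 2) atTop (𝓝 0) :=
      ((tendsto_pow_atTop two_ne_zero).comp hpLN).const_div_atTop 8
    have hLN' : Tendsto (fun T => (L T : ℝ) * N T) atTop atTop := by
      have := (tendsto_natCast_atTop_atTop (R := ℝ)).comp hLNtop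
      simpa [Function.comp_def] using this
    have h4 : Tendsto (fun T => 1 / ((L T : ℝ) * N T) ^ 3) atTop (𝓝 0) :=
      ((tendsto_pow_atTop three_ne_zero).comp hLN').const_div_atTop 1
    have := (h1.const_mul A).add (((h2.add h3).add h4).const_mul 2)
    rwa [add_zero, add_zero, mul_zero, mul_zero, add_zero] at this
  have hlim : Tendsto (fun T => ENNReal.ofReal (b T)) atTop (𝓝 0) := by
    have := ENNReal.tendsto_ofReal hblim
    simpa using this
  exact tendsto_of_tendsto_of_tendsto_of_le_of_le' tendsto_const_nhds hlim
    (Eventually.of_forall fun _ => zero_le) hbound
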